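/- **Definitions.** All graphs are finite. For integers $m,n\ge 0$, an $(m,n)$-colored-mixed graph is a loopless graph with $m$ colors of arcs and $n$ colors of edges in which any two vertices are joined by at most one arc or edge; $(1,0)$-graphs are the oriented graphs and $(0,2)$-graphs are the 2-edge-colored graphs (with colors blue and red). A homomorphism from $G$ to $H$ is a map $\varphi:V(G)\to V(H)$ such that every arc (resp. edge) of $G$ is mapped to an arc (resp. edge) of $H$ of the same color (and orientation). $P_g^{(m,n)}$ is the class of all $(m,n)$-colored-mixed graphs whose underlying graph is planar and has girth at least $g$ (an acyclic graph has infinite girth). A graph $T$ is $P_g^{(m,n)}$-universal if every graph in $P_g^{(m,n)}$ admits a homomorphism to $T$. Let $\overrightarrow{T_5}$ be the oriented graph with vertices $a,b,c,d,e$ and the nine arcs $$ab,\ ac,\ bc,\ bd,\ be,\ cd,\ da,\ de,\ ea$$ (where $xy$ is the arc from $x$ to $y$). Let $T_6$ be the 2-edge-colored graph with vertices $a,b,c,d,e,f$, blue edges $$ab,\ ac,\ af,\ bd,\ de,\ ef$$ and red edges $$ad,\ ae,\ bc,\ be,\ bf,\ cd.$$ **Theorem.** 1. $\overrightarrow{T_5}$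 is a planar $P_{28}^{(1,0)}$-universal graph on 5 vertices: it is planar, and every oriented planar graph of girth at least 28 admits a homomorphism to $\overrightarrow{T_5}$. 2. $T_6$ is a planar $P_{22}^{(0,2)}$-universal graph on 6 vertices: it is planar, and every 2-edge-colored planar graph of girth at least 22 admits a homomorphism to $T_6$. -/

import Mathlib

universe u v

/-- An `(m, n)`-colored-mixed graph on the vertex set `V`: `m` colors of arcs and `n` colors of
edges, no loops, and at most one arc or edge between any two vertices. -/
structure ColoredMixedGraph (m n : ℕ) (V : Type u) where
  /-- `arc i x y`: there is an arc of color `i` from `x` to `y`. -/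
  arc : Fin m → V → V → Prop
  /-- `edge j x y`: there is an edge of color `j` between `x` and `y`. -/
  edge : Fin n → V → V → Prop
  edge_symm : ∀ j x y, edge j x y → edge j y x
  edge_irrefl : ∀ j x, ¬ edge j x x
  /-- No two opposite arcs (of any colors); with `x = y` this also excludes loops. -/
  arc_asymm : ∀ i j x y, arc i x y → ¬ arc j y x
  arc_unique : ∀ i j x y, arc i x y → arc j x y → i = j
  edge_unique : ∀ i j x y, edge i x y → edge j x y → i = j
  arc_not_edge : ∀ i j x y, arc i x y → ¬ edge j x y

/-- `A` is a simple polygonal arc in the plane with endpoints `x` and `y`: the union of the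
segments `[p 0, p 1], …, [p k, p (k + 1)]`, all nondegenerate, where consecutive segments share
only their common endpoint and other segments are disjoint. -/
def IsPolygonalArc (x y : ℝ × ℝ) (A : Set (ℝ × ℝ)) : Prop :=
  ∃ (k : ℕ) (p : ℕ → ℝ × ℝ), p 0 = x ∧ p (k + 1) = y ∧
    (∀ i, i ≤ k → p i ≠ p (i + 1)) ∧
    (∀ i, i + 1 ≤ k →
      segment ℝ (p i) (p (i + 1)) ∩ segment ℝ (p (i + 1)) (p (i + 2)) = {p (i + 1)}) ∧
    (∀ i j, i + 1 < j → j ≤ k →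
      Disjoint (segment ℝ (p i) (p (i + 1))) (segment ℝ (p j) (p (j + 1)))) ∧
    A = ⋃ i ∈ Set.Iic k, segment ℝ (p i) (p (i + 1))

/-- A drawing of `G` in the plane without crossings: vertices are distinct points, the edges are
polygonal arcs joining their ends, an edge contains no vertex other than its ends, and
two distinct edges meet only in common ends. -/
structure PlaneDrawing {V : Type u} (G : SimpleGraph V) where
  point : V → ℝ × ℝ
  curve : Sym2 V → Set (ℝ × ℝ)
  point_injective : Function.Injective point
  isPolygonalArc : ∀ x y, G.Adj x y → IsPolygonalArc (point x) (point y) (curve s(x, y))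
  point_mem_curve : ∀ e ∈ G.edgeSet, ∀ x, point x ∈ curve e → x ∈ e
  curve_inter_curve : ∀ e ∈ G.edgeSet, ∀ f ∈ G.edgeSet, e ≠ f →
    ∀ q ∈ curve e ∩ curve f, ∃ x, x ∈ e ∧ x ∈ f ∧ q = point x

/-- A graph is planar if it can be drawn in the plane without crossings. -/
def IsPlanar {V : Type u} (G : SimpleGraph V) : Prop :=
  Nonempty (PlaneDrawing G)

namespace ColoredMixedGraph

/-- The underlying simple graph, forgetting colors and orientations. -/
def underlying {m n : ℕ} {V : Type u} (G : ColoredMixedGraph m n V) : SimpleGraph V where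
  Adj x y := (∃ i, G.arc i x y ∨ G.arc i y x) ∨ ∃ j, G.edge j x y
  symm := ⟨fun x y h => by
    rcases h with ⟨i, h⟩ | ⟨j, h⟩
    · exact Or.inl ⟨i, h.symm⟩
    · exact Or.inr ⟨j, G.edge_symm j x y h⟩⟩
  loopless := ⟨fun x h => by
    rcases h with ⟨i, h | h⟩ | ⟨j, h⟩
    · exact G.arc_asymm i i x x h h
    · exact G.arc_asymm i i x x h h
    · exact G.edge_irrefl j x h⟩

/-- Homomorphisms preserve arcs and edges together with their colors and orientations. -/
def IsHom {m n : ℕ} {V : Type u} {W : Type v} (G : ColoredMixedGraph m n V)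
    (H : ColoredMixedGraph m n W) (φ : V → W) : Prop :=
  (∀ i x y, G.arc i x y → H.arc i (φ x) (φ y)) ∧
    ∀ j x y, G.edge j x y → H.edge j (φ x) (φ y)

/-- The class of planar `(m, n)`-colored-mixed graphs of girth at least `g`
(acyclic graphs have girth `∞`). -/
def PlanarGirthAtLeast (g : ℕ) {m n : ℕ} {V : Type u} (G : ColoredMixedGraph m n V) : Prop :=
  IsPlanar G.underlying ∧ (g : ℕ∞) ≤ G.underlying.egirth

/-- `T` is universal for the finite planar `(m, n)`-colored-mixed graphs of girth at least `g`:
each of them admits a homomorphism to `T`. -/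
def IsPlanarUniversal (g : ℕ) {m n : ℕ} {W : Type v} (T : ColoredMixedGraph m n W) : Prop :=
  ∀ (V : Type u) [Finite V] (G : ColoredMixedGraph m n V),
    G.PlanarGirthAtLeast g → ∃ φ : V → W, G.IsHom T φ

/-- The oriented graph with vertices `a, b, c, d, e = 0, 1, 2, 3, 4` and arcs
`ab, ac, bc, bd, be, cd, da, de, ea`. -/
def T5 : ColoredMixedGraph 1 0 (Fin 5) where
  arc _ x y := (x, y) ∈ ([(0, 1), (0, 2), (1, 2), (1, 3), (1, 4), (2, 3), (3, 0), (3, 4), (4, 0)] :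
    List (Fin 5 × Fin 5))
  edge _ _ _ := False
  edge_symm := by decide
  edge_irrefl := by decide
  arc_asymm := by decide
  arc_unique := by decide
  edge_unique := by decide
  arc_not_edge := by decide

/-- The blue edges `ab, ac, af, bd, de, ef` of `T6`, with `a, b, c, d, e, f = 0, 1, 2, 3, 4, 5`. -/
def blueT6 : List (Fin 6 × Fin 6) := [(0, 1), (0, 2), (0, 5), (1, 3), (3, 4), (4, 5)]

/-- The red edges `ad, ae, bc, be, bf, cd` of `T6`. -/
def redT6 : List (Fin 6 × Fin 6) := [(0, 3), (0, 4), (1, 2), (1, 4), (1, 5), (2, 3)]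

/-- The 2-edge-colored graph `T6`; color `0` is blue and color `1` is red. -/
def T6 : ColoredMixedGraph 0 2 (Fin 6) where
  arc _ _ _ := False
  edge j x y := (x, y) ∈ ![blueT6, redT6] j ∨ (y, x) ∈ ![blueT6, redT6] j
  edge_symm := by decide
  edge_irrefl := by decide
  arc_asymm := by decide
  arc_unique := by decide
  edge_unique := by decide
  arc_not_edge := by decide

end ColoredMixedGraph

/-!
Both universality statements follow from one criterion, `exists_map_of_reachSets`, whose proof
combines the edge bound of Euler's formula with discharging on a smallest counterexample.

*Edge bound.* For a plane graph of girth at least `g` with at least as many edges as vertices,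
`g (|E| - |V| + 2) ≤ 2 |E|` (`IsPlanar.girth_mul_card_dart_le`). The faces are the orbits of the
permutation of the darts "turn around at the end and take the clockwise next dart". Each orbit
bounds a circulation, and these boundaries add up to zero. What planarity contributes is that they
generate twice every integer circulation `z` (`IsPlanar.exists_face_permutation`): the winding
number of `z` is locally constant off the drawing, it is the same to the left of a dart and of its
successor because nothing lies in the sector between them, and it jumps by the value of `z` across
each edge (`SegmentSystem.exists_face_potential`). Hence at least `|E| - |V| + 2` face boundaries
are nonzero. The support of a nonzero circulation has no bridge, so it contains a cycle, and each
of these boundaries has at least `g` darts. Winding numbers are computed as sums of arguments, with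
all polygonal arcs cut into their segments.

*Discharging.* A vertex gets the charge `(g - 2) deg - 2 g`; by the edge bound the total is
negative. Each vertex of degree two receives `2` from both ends of its thread of vertices of degree
two. So if all threads are short and there are no vertices of degree at most one, some vertex of
degree at least three pays more than it has (`IsPlanar.exists_overcharged`), and the bounds are
chosen such that this vertex has degree three and sees many vertices of degree two.

*Reducibility.* In a smallest graph without a homomorphism, delete a vertex `v` of degree at most
three and vertices of degree two on the threads that start at `v`. As the girth is large, the
deleted part is a spider whose legs are disjoint (`injOn_of_nonbacktracking`), so a homomorphism of
the rest extends as soon as the sets of colors that can reach `v` along the legs intersect. For the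
two target graphs the intersections are verified by computation on the finite families `reachSets`.

The target graphs are drawn with straight edges (`isPlanar_of_straight`).
-/


/-! ### Finite systems of plane segments -/

/-- A drawing by straight segments in the complex plane. The elements of `S` are directed segments,
`rev` reverses the direction, and a common point of two segments that differ as undirected segments
is an end of both. -/
structure SegmentSystem (S : Type*) where
  /-- The initial point of a directed segment. -/
  src : S → ℂ
  /-- The same segment in the opposite direction. -/
  rev : S → S
  rev_rev : ∀ s, rev (rev s) = s
  src_ne : ∀ s, src s ≠ src (rev s)
  inter : ∀ s t q, q ∈ segment ℝ (src s) (src (rev s)) → q ∈ segment ℝ (src t) (src (rev t)) →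
    t = s ∨ t = rev s ∨ (q = src s ∨ q = src (rev s)) ∧ (q = src t ∨ q = src (rev t))

namespace SegmentSystem

variable {S : Type*} (X : SegmentSystem S)

/-- The undirected segment underlying `s`. -/
def seg (s : S) : Set ℂ := segment ℝ (X.src s) (X.src (X.rev s))

/-- The vector from the initial point of `s` to its final point. -/
def dir (s : S) : ℂ := X.src (X.rev s) - X.src s

lemma seg_rev (s : S) : X.seg (X.rev s) = X.seg s := by
  simp [seg, X.rev_rev, segment_symm]

lemma dir_rev (s : S) : X.dir (X.rev s) = - X.dir s := by
  simp [dir, X.rev_rev]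

lemma dir_ne_zero (s : S) : X.dir s ≠ 0 := sub_ne_zero.2 (X.src_ne s).symm

lemma src_rev_eq (s : S) : X.src (X.rev s) = X.src s + X.dir s := by simp [dir]

lemma rev_ne (s : S) : X.rev s ≠ s := fun h => X.src_ne s (by rw [h])

lemma rev_injective : Function.Injective X.rev := fun s t h => by
  rw [← X.rev_rev s, h, X.rev_rev]

lemma src_mem_seg (s : S) : X.src s ∈ X.seg s := left_mem_segment _ _ _

lemma src_rev_mem_seg (s : S) : X.src (X.rev s) ∈ X.seg s := right_mem_segment _ _ _

lemma mem_seg_iff (s : S) (q : ℂ) :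
    q ∈ X.seg s ↔ ∃ t : ℝ, 0 ≤ t ∧ t ≤ 1 ∧ q = X.src s + t * X.dir s := by
  rw [seg, segment_eq_image']
  constructor
  · rintro ⟨t, ⟨h0, h1⟩, rfl⟩
    exact ⟨t, h0, h1, by simp [dir]⟩
  · rintro ⟨t, h0, h1, rfl⟩
    exact ⟨t, ⟨h0, h1⟩, by simp [dir]⟩

lemma isCompact_seg (s : S) : IsCompact (X.seg s) := by
  rw [seg, segment_eq_image']
  exact isCompact_Icc.image (by fun_prop)

/-- Two different directed segments with the same initial point point in different directions. -/
lemma arg_dir_injOn {s t : S} (h : X.src s = X.src t) (harg : (X.dir s).arg = (X.dir t).arg) :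
    s = t := by
  set a := ‖X.dir s‖ with ha
  set b := ‖X.dir t‖ with hb
  have ha0 : 0 < a := norm_pos_iff.2 (X.dir_ne_zero s)
  have hb0 : 0 < b := norm_pos_iff.2 (X.dir_ne_zero t)
  have hs : X.dir s = a * Complex.exp ((X.dir t).arg * Complex.I) := by
    rw [← harg, Complex.norm_mul_exp_arg_mul_I]
  have ht : X.dir t = b * Complex.exp ((X.dir t).arg * Complex.I) :=
    (Complex.norm_mul_exp_arg_mul_I _).symm
  set u := Complex.exp ((X.dir t).arg * Complex.I) with hu
  have hu0 : u ≠ 0 := Complex.exp_ne_zero _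
  -- a point of both segments that is an end of neither
  set r : ℝ := min a b / 2 with hr
  have hr0 : 0 < r := by positivity
  have hra : r < a := by have := min_le_left a b; linarith
  have hrb : r < b := by have := min_le_right a b; linarith
  have hac : (a : ℂ) ≠ 0 := by exact_mod_cast ha0.ne'
  have hbc : (b : ℂ) ≠ 0 := by exact_mod_cast hb0.ne'
  have h1 : X.src s + r * u ∈ X.seg s := by
    rw [mem_seg_iff]
    refine ⟨r / a, by positivity, (div_le_one ha0).2 hra.le, ?_⟩
    rw [hs]; push_cast; field_simp
  have h2 : X.src s + r * u ∈ X.seg t := by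
    rw [mem_seg_iff]
    refine ⟨r / b, by positivity, (div_le_one hb0).2 hrb.le, ?_⟩
    rw [ht, h]; push_cast; field_simp
  rcases X.inter s t _ h1 h2 with h3 | h3 | ⟨h3, -⟩
  · exact h3.symm
  · exact absurd (h.trans (congrArg X.src h3)) (X.src_ne s)
  · rcases h3 with h3 | h3
    · have : (r : ℂ) * u = 0 := by simpa using h3
      rcases mul_eq_zero.1 this with h4 | h4
      · exact absurd (by exact_mod_cast h4) hr0.ne'
      · exact absurd h4 hu0
    · rw [src_rev_eq, hs] at h3
      have : (r : ℂ) = a := mul_right_cancel₀ hu0 (add_left_cancel h3)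
      exact absurd (by exact_mod_cast this) hra.ne

/-! ### Winding numbers -/

/-- The angle under which the directed segment `s` is seen from `q`. -/
noncomputable def angle (s : S) (q : ℂ) : ℝ :=
  ((X.src (X.rev s) - q) / (X.src s - q)).arg

lemma div_mem_slitPlane {s : S} {q : ℂ} (hq : q ∉ X.seg s) :
    (X.src (X.rev s) - q) / (X.src s - q) ∈ Complex.slitPlane := by
  have ha : X.src s - q ≠ 0 := sub_ne_zero.2 fun h => hq (h ▸ X.src_mem_seg s)
  by_contra hns
  rw [Complex.mem_slitPlane_iff] at hns
  push Not at hns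
  obtain ⟨hre, him⟩ := hns
  set z := (X.src (X.rev s) - q) / (X.src s - q) with hz
  have hzr : z = ((z.re : ℝ) : ℂ) := by apply Complex.ext <;> simp [him]
  have hmul : X.src (X.rev s) - q = z * (X.src s - q) := by rw [hz]; field_simp
  apply hq
  rw [mem_seg_iff]
  have hpos : 0 < 1 - z.re := by linarith
  have hposc : (1 - (z.re : ℂ)) ≠ 0 := by exact_mod_cast hpos.ne'
  refine ⟨1 / (1 - z.re), by positivity, (div_le_one hpos).2 (by linarith), ?_⟩
  rw [dir]
  have : X.src (X.rev s) - X.src s = (z - 1) * (X.src s - q) := by linear_combination hmul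
  rw [this, Complex.ofReal_div, Complex.ofReal_sub, Complex.ofReal_one, ← hzr]
  rw [← hzr] at hposc
  field_simp
  ring

lemma continuousAt_angle {s : S} {q : ℂ} (hq : q ∉ X.seg s) : ContinuousAt (X.angle s) q := by
  have ha : X.src s - q ≠ 0 := sub_ne_zero.2 fun h => hq (h ▸ X.src_mem_seg s)
  have h := Complex.continuousAt_arg (X.div_mem_slitPlane hq)
  have h2 : ContinuousAt (fun q => (X.src (X.rev s) - q) / (X.src s - q)) q := by
    apply ContinuousAt.div _ _ ha <;> fun_prop
  exact ContinuousAt.comp (f := fun q => (X.src (X.rev s) - q) / (X.src s - q)) h h2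

/-- The sum, over all directed segments, of the angles seen from `q`, weighted by `z`, in full
turns. Each undirected segment occurs twice, so for antisymmetric `z` this is twice the winding
number of `z` around `q`. -/
noncomputable def winding [Fintype S] (z : S → ℤ) (q : ℂ) : ℝ :=
  (∑ s, z s * X.angle s q) / (2 * Real.pi)

/-- An integer circulation on a system of segments: antisymmetric, and with no net flow out of any
point. -/
structure IsCirculation [Fintype S] (z : S → ℤ) : Prop where
  rev : ∀ s, z (X.rev s) = - z s
  sum_src : ∀ v, (∑ s with X.src s = v, z s) = 0

lemma continuousAt_winding [Fintype S] (z : S → ℤ) {q : ℂ} (hq : ∀ s, q ∉ X.seg s) :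
    ContinuousAt (X.winding z) q := by
  unfold winding
  refine ContinuousAt.div_const ?_ _
  refine tendsto_finsetSum _ fun s _ => ?_
  exact (continuousAt_const.mul (X.continuousAt_angle (hq s)))

lemma prod_zpow_src [Fintype S] {z : S → ℤ} (hz : X.IsCirculation z) (f : ℂ → ℂ)
    (hf : ∀ s, f (X.src s) ≠ 0) : ∏ s, f (X.src s) ^ z s = 1 := by
  classical
  rw [← Finset.prod_fiberwise_of_maps_to (s := Finset.univ) (t := Finset.univ.image X.src)
    (g := X.src) (fun s _ => Finset.mem_image_of_mem _ (Finset.mem_univ s))]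
  refine Finset.prod_eq_one fun v hv => ?_
  obtain ⟨s₀, -, rfl⟩ := Finset.mem_image.1 hv
  have h1 : ∀ s ∈ Finset.univ.filter (fun s => X.src s = X.src s₀),
      f (X.src s) ^ z s = f (X.src s₀) ^ z s := by
    intro s hs
    rw [(Finset.mem_filter.1 hs).2]
  rw [Finset.prod_congr rfl h1]
  have key : ∀ T : Finset S, ∏ s ∈ T, f (X.src s₀) ^ z s = f (X.src s₀) ^ ∑ s ∈ T, z s := by
    intro T
    induction T using Finset.induction_on with
    | empty => simp
    | insert a T ha ih =>
      rw [Finset.prod_insert ha, Finset.sum_insert ha, ih, zpow_add₀ (hf s₀)]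
  rw [key]
  have := hz.sum_src (X.src s₀)
  simp only [this, zpow_zero]

lemma exp_angle {s : S} {q : ℂ} (hq : q ∉ X.seg s) :
    Complex.exp (X.angle s q * Complex.I) =
      ((X.src (X.rev s) - q) / ‖X.src (X.rev s) - q‖) / ((X.src s - q) / ‖X.src s - q‖) := by
  have ha : X.src s - q ≠ 0 := sub_ne_zero.2 fun h => hq (h ▸ X.src_mem_seg s)
  have hb : X.src (X.rev s) - q ≠ 0 := sub_ne_zero.2 fun h => hq (h ▸ X.src_rev_mem_seg s)
  have h := Complex.norm_mul_exp_arg_mul_I ((X.src (X.rev s) - q) / (X.src s - q))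
  rw [norm_div] at h
  have h1 : (‖X.src s - q‖ : ℂ) ≠ 0 := by simpa using ha
  have h2 : (‖X.src (X.rev s) - q‖ : ℂ) ≠ 0 := by simpa using hb
  unfold angle
  push_cast at h
  field_simp at h ⊢
  linear_combination h

/-- A closed flow winds a whole number of times around each point off its segments, because the
unit vectors towards the ends of the segments cancel. -/
lemma exists_winding_eq_intCast [Fintype S] {z : S → ℤ} (hz : X.IsCirculation z) {q : ℂ}
    (hq : ∀ s, q ∉ X.seg s) : ∃ n : ℤ, X.winding z q = n := by
  classical
  set N : ℂ → ℂ := fun p => (p - q) / ‖p - q‖ with hN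
  have hN0 : ∀ s, N (X.src s) ≠ 0 := by
    intro s
    have ha : X.src s - q ≠ 0 := sub_ne_zero.2 fun h => hq s (h ▸ X.src_mem_seg s)
    simp [hN, ha]
  have h1 : Complex.exp ((∑ s, z s * X.angle s q : ℝ) * Complex.I) = 1 := by
    push_cast
    rw [Finset.sum_mul, Complex.exp_sum]
    have h2 : ∀ s ∈ (Finset.univ : Finset S), Complex.exp (z s * X.angle s q * Complex.I) =
        N (X.src (X.rev s)) ^ z s * (N (X.src s) ^ z s)⁻¹ := by
      intro s _
      rw [mul_assoc, Complex.exp_int_mul, X.exp_angle (hq s), div_zpow]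
      rfl
    rw [Finset.prod_congr rfl h2, Finset.prod_mul_distrib, Finset.prod_inv_distrib,
      X.prod_zpow_src hz N hN0]
    have h3 : ∏ s, N (X.src (X.rev s)) ^ z s = ∏ s, (N (X.src s) ^ z s)⁻¹ := by
      refine Fintype.prod_bijective X.rev
        (Function.Involutive.bijective X.rev_rev) _ _ fun s => ?_
      rw [hz.rev, zpow_neg, inv_inv]
    rw [h3, Finset.prod_inv_distrib, X.prod_zpow_src hz N hN0]
    simp
  obtain ⟨n, hn⟩ := Complex.exp_eq_one_iff.1 h1
  refine ⟨n, ?_⟩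
  have h4 : ((∑ s, z s * X.angle s q : ℝ) : ℂ) = ((n * (2 * Real.pi) : ℝ) : ℂ) := by
    have := mul_right_cancel₀ Complex.I_ne_zero
      (hn.trans (by ring : _ = ((n : ℂ) * (2 * Real.pi)) * Complex.I))
    rw [this]; push_cast; ring
  have h5 : (∑ s, z s * X.angle s q : ℝ) = n * (2 * Real.pi) := by exact_mod_cast h4
  rw [winding, h5]
  field_simp

lemma winding_eq_of_isPreconnected [Fintype S] {z : S → ℤ} (hz : X.IsCirculation z) {U : Set ℂ}
    (hU : IsPreconnected U) (hd : ∀ q ∈ U, ∀ s, q ∉ X.seg s) {p q : ℂ} (hp : p ∈ U) (hq : q ∈ U) :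
    X.winding z p = X.winding z q := by
  refine IsPreconnected.constant_of_mapsTo (T := Set.range ((↑) : ℤ → ℝ)) hU ?_ ?_ ?_ hp hq
  · exact Int.isClosedEmbedding_coe_real.isInducing.isDiscrete_range
  · exact fun x hx => (X.continuousAt_winding z (hd x hx)).continuousWithinAt
  · intro x hx
    obtain ⟨n, hn⟩ := X.exists_winding_eq_intCast hz (hd x hx)
    exact ⟨n, hn.symm⟩

open Filter Topology

/-! ### The left side of a segment -/

/-- The thin open triangle on the left side of the directed segment `s` whose base is the segment
and whose slopes are at most `ε`. -/
def leftTriangle (ε : ℝ) (s : S) : Set ℂ :=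
  {q | ∃ x y : ℝ, 0 < y ∧ y < ε * x ∧ y < ε * (1 - x) ∧
    q = X.src s + (x + y * Complex.I) * X.dir s}

lemma isPreconnected_leftTriangle (ε : ℝ) (s : S) : IsPreconnected (X.leftTriangle ε s) := by
  apply Convex.isPreconnected
  rintro _ ⟨x, y, h1, h2, h3, rfl⟩ _ ⟨x', y', h1', h2', h3', rfl⟩ a b ha hb hab
  refine ⟨a * x + b * x', a * y + b * y', ?_, ?_, ?_, ?_⟩
  · rcases ha.eq_or_lt with rfl | ha
    · have : b = 1 := by linarith
      subst this; simpa using h1'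
    · have := mul_pos ha h1
      have := mul_nonneg hb h1'.le
      linarith
  · rcases ha.eq_or_lt with rfl | ha
    · have : b = 1 := by linarith
      subst this; simpa using h2'
    · have := mul_lt_mul_of_pos_left h2 ha
      have := mul_le_mul_of_nonneg_left h2'.le hb
      linarith
  · have e : ε * (1 - (a * x + b * x')) = a * (ε * (1 - x)) + b * (ε * (1 - x')) := by
      linear_combination (-ε) * hab
    rw [e]
    rcases ha.eq_or_lt with rfl | ha
    · have : b = 1 := by linarith
      subst this; simpa using h3'
    · have := mul_lt_mul_of_pos_left h3 ha
      have := mul_le_mul_of_nonneg_left h3'.le hb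
      linarith
  · have hab' : (a : ℂ) + b = 1 := by exact_mod_cast hab
    simp only [Complex.real_smul]
    push_cast
    linear_combination (X.src s) * hab'

/-- Coordinates with respect to `dir s` are unique. -/
lemma coord_unique (s : S) {x y x' y' : ℝ}
    (h : ((x : ℂ) + y * Complex.I) * X.dir s = (x' + y' * Complex.I) * X.dir s) :
    x = x' ∧ y = y' := by
  have := mul_right_cancel₀ (X.dir_ne_zero s) h
  exact ⟨by simpa using congrArg Complex.re this, by simpa using congrArg Complex.im this⟩

lemma exists_coord (s : S) (w : ℂ) : ∃ c d : ℝ, w = (c + d * Complex.I) * X.dir s := by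
  refine ⟨(w / X.dir s).re, (w / X.dir s).im, ?_⟩
  rw [Complex.re_add_im, div_mul_cancel₀ _ (X.dir_ne_zero s)]

lemma eventually_mul_lt {d : ℝ} (hd : 0 < d) (c : ℝ) : ∀ᶠ ε in 𝓝[>] (0 : ℝ), ε * c < d := by
  have : Tendsto (fun ε : ℝ => ε * c) (𝓝[>] 0) (𝓝 (0 * c)) :=
    ((continuous_id.mul continuous_const).tendsto 0).mono_left nhdsWithin_le_nhds
  rw [zero_mul] at this
  exact this.eventually (gt_mem_nhds hd)

lemma eventually_leftTriangle_of_src_eq (s t : S) (h : X.src t = X.src s) :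
    ∀ᶠ ε in 𝓝[>] (0 : ℝ), ∀ q ∈ X.leftTriangle ε s, q ∉ X.seg t := by
  obtain ⟨c, d, hcd⟩ := X.exists_coord s (X.dir t)
  have key : ∀ ε : ℝ, 0 < ε → (0 < d → ε * c < d) → ∀ q ∈ X.leftTriangle ε s, q ∉ X.seg t := by
    rintro ε - hc q ⟨x, y, h1, h2, h3, rfl⟩ hq
    obtain ⟨r, hr0, -, hr⟩ := (X.mem_seg_iff t _).1 hq
    rw [h, hcd] at hr
    have h4 := X.coord_unique s (x := x) (y := y) (x' := r * c) (y' := r * d)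
      (by push_cast; linear_combination hr)
    obtain ⟨rfl, rfl⟩ := h4
    have hd : 0 < d := by
      by_contra hd
      nlinarith
    have hr' : 0 < r := by
      rcases hr0.eq_or_lt with rfl | h
      · simp at h1
      · exact h
    have := mul_lt_mul_of_pos_left (hc hd) hr'
    nlinarith
  by_cases hd : 0 < d
  · filter_upwards [eventually_mul_lt hd c, self_mem_nhdsWithin] with ε h1 h2
    exact key ε h2 fun _ => h1
  · filter_upwards [self_mem_nhdsWithin] with ε h2
    exact key ε h2 fun h => absurd h hd

lemma eventually_leftTriangle_of_src_eq_src_rev (s t : S) (h : X.src t = X.src (X.rev s)) :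
    ∀ᶠ ε in 𝓝[>] (0 : ℝ), ∀ q ∈ X.leftTriangle ε s, q ∉ X.seg t := by
  obtain ⟨c, d, hcd⟩ := X.exists_coord s (X.dir t)
  have key : ∀ ε : ℝ, 0 < ε → (0 < d → ε * (-c) < d) →
      ∀ q ∈ X.leftTriangle ε s, q ∉ X.seg t := by
    rintro ε - hc q ⟨x, y, h1, h2, h3, rfl⟩ hq
    obtain ⟨r, hr0, -, hr⟩ := (X.mem_seg_iff t _).1 hq
    rw [h, src_rev_eq, hcd] at hr
    have h4 := X.coord_unique s (x := x) (y := y) (x' := 1 + r * c) (y' := r * d)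
      (by push_cast; linear_combination hr)
    obtain ⟨rfl, rfl⟩ := h4
    have hd : 0 < d := by
      by_contra hd
      nlinarith
    have hr' : 0 < r := by
      rcases hr0.eq_or_lt with rfl | h
      · simp at h1
      · exact h
    have := mul_lt_mul_of_pos_left (hc hd) hr'
    nlinarith
  by_cases hd : 0 < d
  · filter_upwards [eventually_mul_lt hd (-c), self_mem_nhdsWithin] with ε h1 h2
    exact key ε h2 fun _ => h1
  · filter_upwards [self_mem_nhdsWithin] with ε h2
    exact key ε h2 fun h => absurd h hd

lemma eventually_leftTriangle_of_disjoint (s t : S) (h : Disjoint (X.seg s) (X.seg t)) :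
    ∀ᶠ ε in 𝓝[>] (0 : ℝ), ∀ q ∈ X.leftTriangle ε s, q ∉ X.seg t := by
  obtain ⟨δ, hδ, hdis⟩ := h.exists_thickenings (X.isCompact_seg s) (X.isCompact_seg t).isClosed
  filter_upwards [eventually_mul_lt hδ ‖X.dir s‖, self_mem_nhdsWithin] with ε h1 h2
  rintro q ⟨x, y, hy, h3, h4, rfl⟩ hq
  have h2 : 0 < ε := h2
  have hx0 : 0 < x := by by_contra; nlinarith
  have hx1 : 0 < 1 - x := by by_contra; nlinarith
  have hyε : y < ε := by nlinarith
  refine Set.disjoint_left.1 hdis ?_ (Metric.self_subset_thickening hδ _ hq)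
  rw [Metric.mem_thickening_iff]
  refine ⟨X.src s + x * X.dir s, (X.mem_seg_iff _ _).2 ⟨x, hx0.le, by linarith, rfl⟩, ?_⟩
  rw [dist_eq_norm]
  have : X.src s + (x + y * Complex.I) * X.dir s - (X.src s + x * X.dir s) =
    y * Complex.I * X.dir s := by ring
  rw [this]
  simp only [norm_mul, Complex.norm_real, Complex.norm_I, mul_one, Real.norm_eq_abs, abs_of_pos hy]
  calc y * ‖X.dir s‖ < ε * ‖X.dir s‖ :=
        mul_lt_mul_of_pos_right hyε (norm_pos_iff.2 (X.dir_ne_zero s))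
    _ < δ := h1

lemma eventually_leftTriangle (s t : S) :
    ∀ᶠ ε in 𝓝[>] (0 : ℝ), ∀ q ∈ X.leftTriangle ε s, q ∉ X.seg t := by
  by_cases hd : Disjoint (X.seg s) (X.seg t)
  · exact X.eventually_leftTriangle_of_disjoint s t hd
  obtain ⟨q, hs, ht⟩ := Set.not_disjoint_iff.1 hd
  rcases X.inter s t q hs ht with rfl | rfl | ⟨h1, h2⟩
  · exact X.eventually_leftTriangle_of_src_eq t t rfl
  · exact X.eventually_leftTriangle_of_src_eq_src_rev s _ rfl
  · rw [← X.seg_rev t]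
    rcases h1 with rfl | rfl <;> rcases h2 with h2 | h2
    · rw [X.seg_rev]
      exact X.eventually_leftTriangle_of_src_eq s t h2.symm
    · exact X.eventually_leftTriangle_of_src_eq s _ h2.symm
    · rw [X.seg_rev]
      exact X.eventually_leftTriangle_of_src_eq_src_rev s t h2.symm
    · exact X.eventually_leftTriangle_of_src_eq_src_rev s _ h2.symm

/-- Some slope makes all left triangles disjoint from all segments. -/
lemma exists_leftTriangle_disjoint [Finite S] :
    ∃ ε : ℝ, 0 < ε ∧ ∀ s t, ∀ q ∈ X.leftTriangle ε s, q ∉ X.seg t := by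
  have h1 : ∀ᶠ ε in 𝓝[>] (0 : ℝ), ∀ s t, ∀ q ∈ X.leftTriangle ε s, q ∉ X.seg t :=
    eventually_all.2 fun s => eventually_all.2 fun t => X.eventually_leftTriangle s t
  obtain ⟨ε, h2, h3⟩ := (h1.and self_mem_nhdsWithin).exists
  exact ⟨ε, h3, h2⟩

/-- The point over the midpoint of `s`, at distance `y` to the left in units of the length. -/
noncomputable def leftPoint (s : S) (y : ℝ) : ℂ := X.src s + ((1 / 2 : ℝ) + y * Complex.I) * X.dir s

lemma leftPoint_mem {ε y : ℝ} (hy : 0 < y) (h : y < ε / 2) (s : S) :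
    X.leftPoint s y ∈ X.leftTriangle ε s :=
  ⟨1 / 2, y, hy, by linarith, by linarith, rfl⟩

lemma leftPoint_rev (s : S) (y : ℝ) : X.leftPoint (X.rev s) y = X.leftPoint s (-y) := by
  simp only [leftPoint, X.dir_rev, X.src_rev_eq]
  push_cast
  ring

lemma leftPoint_zero_mem (s : S) : X.leftPoint s 0 ∈ X.seg s :=
  (X.mem_seg_iff _ _).2 ⟨1 / 2, by norm_num, by norm_num, by simp [leftPoint]⟩

lemma continuous_leftPoint (s : S) : Continuous (X.leftPoint s) := by
  unfold leftPoint
  fun_prop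

/-! ### The jump of the winding number across a segment -/

lemma div_leftPoint (s : S) (y : ℝ) :
    (X.src (X.rev s) - X.leftPoint s y) / (X.src s - X.leftPoint s y) =
      (((y ^ 2 - 1 / 4) / (y ^ 2 + 1 / 4) : ℝ) : ℂ) + ((y / (y ^ 2 + 1 / 4) : ℝ) : ℂ) * Complex.I := by
  have hd := X.dir_ne_zero s
  have h1 : X.src (X.rev s) - X.leftPoint s y = (1 / 2 - y * Complex.I) * X.dir s := by
    rw [src_rev_eq, leftPoint]; push_cast; ring
  have h2 : X.src s - X.leftPoint s y = (-1 / 2 - y * Complex.I) * X.dir s := by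
    rw [leftPoint]; push_cast; ring
  have hy : (0 : ℝ) < y ^ 2 + 1 / 4 := by positivity
  have hyc : ((y : ℂ) ^ 2 + 1 / 4) ≠ 0 := by
    have : ((y ^ 2 + 1 / 4 : ℝ) : ℂ) ≠ 0 := by exact_mod_cast hy.ne'
    push_cast at this
    exact this
  have h3 : (-1 / 2 - y * Complex.I) ≠ 0 := by
    intro h
    have := congrArg Complex.re h
    norm_num at this
  rw [h1, h2, mul_div_mul_right _ _ hd, div_eq_iff h3]
  push_cast
  have e : ((y : ℂ) ^ 2 - 1 / 4) / (y ^ 2 + 1 / 4) + y / (y ^ 2 + 1 / 4) * Complex.I =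
      ((y : ℂ) ^ 2 - 1 / 4 + y * Complex.I) / (y ^ 2 + 1 / 4) := by ring
  rw [e, div_mul_eq_mul_div, eq_div_iff hyc]
  linear_combination (y : ℂ) ^ 2 * Complex.I_sq

lemma tendsto_div_leftPoint (s : S) : Tendsto (fun y : ℝ =>
    (X.src (X.rev s) - X.leftPoint s y) / (X.src s - X.leftPoint s y)) (𝓝 0) (𝓝 (-1)) := by
  simp_rw [X.div_leftPoint]
  have hne : ∀ y : ℝ, y ^ 2 + 1 / 4 ≠ 0 := fun y => by positivity
  have h : Continuous fun y : ℝ => (((y ^ 2 - 1 / 4) / (y ^ 2 + 1 / 4) : ℝ) : ℂ) +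
      ((y / (y ^ 2 + 1 / 4) : ℝ) : ℂ) * Complex.I := by
    have h1 : Continuous fun y : ℝ => (y ^ 2 - 1 / 4) / (y ^ 2 + 1 / 4) := by fun_prop (disch := exact hne _)
    have h2 : Continuous fun y : ℝ => y / (y ^ 2 + 1 / 4) := by fun_prop (disch := exact hne _)
    fun_prop
  have := h.tendsto 0
  have e : (((0 ^ 2 - 1 / 4) / (0 ^ 2 + 1 / 4) : ℝ) : ℂ) + ((0 / (0 ^ 2 + 1 / 4) : ℝ) : ℂ) * Complex.I
      = -1 := by norm_num
  rwa [e] at this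

lemma tendsto_angle_left (s : S) :
    Tendsto (fun y => X.angle s (X.leftPoint s y)) (𝓝[>] 0) (𝓝 Real.pi) := by
  have h := Complex.tendsto_arg_nhdsWithin_im_nonneg_of_re_neg_of_im_zero (z := -1)
    (by norm_num) (by norm_num)
  refine h.comp (tendsto_nhdsWithin_iff.2
    ⟨(X.tendsto_div_leftPoint s).mono_left nhdsWithin_le_nhds, ?_⟩)
  filter_upwards [self_mem_nhdsWithin] with y hy
  have hy : 0 < y := hy
  rw [X.div_leftPoint]
  show 0 ≤ Complex.im _
  rw [Complex.add_im, Complex.ofReal_im, Complex.im_ofReal_mul, Complex.I_im, mul_one, zero_add]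
  positivity

lemma tendsto_angle_right (s : S) :
    Tendsto (fun y => X.angle s (X.leftPoint s y)) (𝓝[<] 0) (𝓝 (-Real.pi)) := by
  have h := Complex.tendsto_arg_nhdsWithin_im_neg_of_re_neg_of_im_zero (z := -1)
    (by norm_num) (by norm_num)
  refine h.comp (tendsto_nhdsWithin_iff.2
    ⟨(X.tendsto_div_leftPoint s).mono_left nhdsWithin_le_nhds, ?_⟩)
  filter_upwards [self_mem_nhdsWithin] with y hy
  have hy : y < 0 := hy
  rw [X.div_leftPoint]
  show Complex.im _ < 0
  rw [Complex.add_im, Complex.ofReal_im, Complex.im_ofReal_mul, Complex.I_im, mul_one, zero_add]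
  exact div_neg_of_neg_of_pos hy (by positivity)

lemma leftPoint_zero_notMem_seg {s t : S} (h1 : t ≠ s) (h2 : t ≠ X.rev s) :
    X.leftPoint s 0 ∉ X.seg t := by
  intro h
  rcases X.inter s t _ (X.leftPoint_zero_mem s) h with h | h | ⟨h, -⟩
  · exact h1 h
  · exact h2 h
  · rcases h with h | h
    · simp [leftPoint, X.dir_ne_zero] at h
    · rw [src_rev_eq, leftPoint] at h
      have := mul_right_cancel₀ (X.dir_ne_zero s)
        ((add_left_cancel h).trans (one_mul (X.dir s)).symm)
      norm_num at this

/-- Crossing `s` from right to left changes the weighted angle sum by two turns per unit of `z s`,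
one for each of the two directed segments `s` and `rev s`. -/
lemma winding_jump [Fintype S] {z : S → ℤ} (hz : ∀ s, z (X.rev s) = - z s) (s : S) {l r : ℝ}
    (hl : ∀ᶠ y in 𝓝[>] (0 : ℝ), X.winding z (X.leftPoint s y) = l)
    (hr : ∀ᶠ y in 𝓝[>] (0 : ℝ), X.winding z (X.leftPoint (X.rev s) y) = r) :
    l - r = 2 * z s := by
  classical
  set T : Finset S := {s, X.rev s} with hT
  set R : ℝ := (∑ t ∈ Finset.univ \ T, z t * X.angle t (X.leftPoint s 0)) with hR
  have hsplit : ∀ q, X.winding z q = ((∑ t ∈ Finset.univ \ T, z t * X.angle t q) +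
      (z s * X.angle s q - z s * X.angle (X.rev s) q)) / (2 * Real.pi) := by
    intro q
    have h1 : (∑ t ∈ T, (z t : ℝ) * X.angle t q) =
        z s * X.angle s q - z s * X.angle (X.rev s) q := by
      rw [hT, Finset.sum_pair (X.rev_ne s).symm, hz]
      push_cast
      ring
    rw [winding, ← h1, Finset.sum_sdiff (Finset.subset_univ T)]
  have hrest : Tendsto (fun y => ∑ t ∈ Finset.univ \ T, (z t : ℝ) * X.angle t (X.leftPoint s y))
      (𝓝 0) (𝓝 R) := by
    refine tendsto_finsetSum _ fun t ht => Tendsto.mul tendsto_const_nhds ?_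
    simp only [hT, Finset.mem_sdiff, Finset.mem_univ, true_and, Finset.mem_insert,
      Finset.mem_singleton, not_or] at ht
    exact (X.continuousAt_angle (X.leftPoint_zero_notMem_seg ht.1 ht.2)).tendsto.comp
      ((X.continuous_leftPoint s).tendsto 0)
  have hneg : Tendsto (fun y : ℝ => -y) (𝓝[>] 0) (𝓝[<] 0) := by
    simpa using tendsto_neg_nhdsGT (a := (0 : ℝ))
  have hneg' : Tendsto (fun y : ℝ => -y) (𝓝[<] 0) (𝓝[>] 0) := by
    simpa using tendsto_neg_nhdsLT (a := (0 : ℝ))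
  have hrev : ∀ y, X.leftPoint s y = X.leftPoint (X.rev s) (-y) := fun y => by
    rw [leftPoint_rev, neg_neg]
  -- the limits of the angle sum from the two sides
  have hL : Tendsto (fun y => X.winding z (X.leftPoint s y)) (𝓝[>] 0)
      (𝓝 ((R + (z s * Real.pi - z s * (-Real.pi))) / (2 * Real.pi))) := by
    simp_rw [hsplit]
    refine Tendsto.div_const (Tendsto.add (hrest.mono_left nhdsWithin_le_nhds)
      (Tendsto.sub (Tendsto.const_mul _ (X.tendsto_angle_left s)) (Tendsto.const_mul _ ?_))) _
    simp_rw [hrev]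
    exact (X.tendsto_angle_right (X.rev s)).comp hneg
  have hR' : Tendsto (fun y => X.winding z (X.leftPoint s y)) (𝓝[<] 0)
      (𝓝 ((R + (z s * (-Real.pi) - z s * Real.pi)) / (2 * Real.pi))) := by
    simp_rw [hsplit]
    refine Tendsto.div_const (Tendsto.add (hrest.mono_left nhdsWithin_le_nhds)
      (Tendsto.sub (Tendsto.const_mul _ (X.tendsto_angle_right s)) (Tendsto.const_mul _ ?_))) _
    simp_rw [hrev]
    exact (X.tendsto_angle_left (X.rev s)).comp hneg'
  have e1 := tendsto_nhds_unique hL (tendsto_const_nhds.congr' (hl.mono fun y hy => hy.symm))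
  have hr' : ∀ᶠ y in 𝓝[<] (0 : ℝ), X.winding z (X.leftPoint s y) = r := by
    refine (hneg'.eventually hr).mono fun y hy => ?_
    rwa [← hrev] at hy
  have e2 := tendsto_nhds_unique hR' (tendsto_const_nhds.congr' (hr'.mono fun y hy => hy.symm))
  rw [← e1, ← e2]
  field_simp
  ring

/-! ### The rotation at a point and the faces -/

/-- The angle in `(0, 2π]` by which the direction of `u` has to be turned counterclockwise to become
the direction of `t`; it is `2π` when the directions agree. -/
noncomputable def gap (t u : S) : ℝ :=
  toIocMod Real.two_pi_pos 0 ((X.dir t).arg - (X.dir u).arg)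

lemma gap_pos (t u : S) : 0 < X.gap t u := (toIocMod_mem_Ioc Real.two_pi_pos 0 _).1

lemma gap_le (t u : S) : X.gap t u ≤ 2 * Real.pi := by
  have h := (toIocMod_mem_Ioc Real.two_pi_pos 0 ((X.dir t).arg - (X.dir u).arg)).2
  rwa [zero_add] at h

lemma gap_spec (t u : S) :
    ∃ n : ℤ, (X.dir t).arg - (X.dir u).arg = X.gap t u + n * (2 * Real.pi) := by
  refine ⟨toIocDiv Real.two_pi_pos 0 ((X.dir t).arg - (X.dir u).arg), ?_⟩
  have := toIocMod_add_toIocDiv_zsmul Real.two_pi_pos 0 ((X.dir t).arg - (X.dir u).arg)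
  rw [zsmul_eq_mul] at this
  exact this.symm

lemma gap_eq {t u : S} {c : ℝ} (h0 : 0 < c) (h1 : c ≤ 2 * Real.pi) {n : ℤ}
    (h : (X.dir t).arg - (X.dir u).arg = c + n * (2 * Real.pi)) : X.gap t u = c :=
  (toIocMod_eq_iff Real.two_pi_pos).2 ⟨⟨h0, by simpa using h1⟩, n, by rw [h, zsmul_eq_mul]⟩

lemma arg_dir_eq_of_gap_eq {t t' u : S} (h : X.gap t u = X.gap t' u) :
    (X.dir t).arg = (X.dir t').arg := by
  obtain ⟨n, hn⟩ := X.gap_spec t u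
  obtain ⟨m, hm⟩ := X.gap_spec t' u
  have h1 := Complex.arg_mem_Ioc (X.dir t)
  have h2 := Complex.arg_mem_Ioc (X.dir t')
  have e : (X.dir t).arg - (X.dir t').arg = ((n - m : ℤ) : ℝ) * (2 * Real.pi) := by
    push_cast; linarith
  have hp := Real.pi_pos
  have h3 : ((n - m : ℤ) : ℝ) < 1 := by
    by_contra h
    push Not at h
    nlinarith [h1.1, h1.2, h2.1, h2.2]
  have h4 : (-1 : ℝ) < ((n - m : ℤ) : ℝ) := by
    by_contra h
    push Not at h
    nlinarith [h1.1, h1.2, h2.1, h2.2]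
  have h5 : n - m = 0 := by
    have h3' : n - m < 1 := by exact_mod_cast h3
    have h4' : -1 < n - m := by exact_mod_cast h4
    omega
  rw [h5] at e
  simp at e
  linarith

lemma exists_minimal_gap [Finite S] (t : S) :
    ∃ u, X.src u = X.src t ∧ ∀ u', X.src u' = X.src t → X.gap t u ≤ X.gap t u' := by
  obtain ⟨u, hu, h⟩ := Set.exists_min_image {u | X.src u = X.src t} (X.gap t)
    (Set.toFinite _) ⟨t, rfl⟩
  exact ⟨u, hu, h⟩

/-- The clockwise successor of `t` among the directed segments with the same initial point. -/
noncomputable def clockwiseNext [Finite S] (t : S) : S := (X.exists_minimal_gap t).choose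

lemma src_clockwiseNext [Finite S] (t : S) : X.src (X.clockwiseNext t) = X.src t :=
  (X.exists_minimal_gap t).choose_spec.1

lemma gap_clockwiseNext_le [Finite S] {t u : S} (h : X.src u = X.src t) :
    X.gap t (X.clockwiseNext t) ≤ X.gap t u :=
  (X.exists_minimal_gap t).choose_spec.2 u h

lemma clockwiseNext_injective [Finite S] : Function.Injective X.clockwiseNext := by
  have key : ∀ t t', X.clockwiseNext t = X.clockwiseNext t' →
      X.gap t' (X.clockwiseNext t') ≤ X.gap t (X.clockwiseNext t) → t = t' := by
    intro t t' h hle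
    have hsrc : X.src t = X.src t' := by
      rw [← X.src_clockwiseNext t, h, X.src_clockwiseNext]
    rw [← h] at hle
    rcases hle.eq_or_lt with heq | hlt
    · exact X.arg_dir_injOn hsrc (X.arg_dir_eq_of_gap_eq heq.symm)
    · -- otherwise `t'` lies strictly between `t` and its clockwise successor
      exfalso
      obtain ⟨n, hn⟩ := X.gap_spec t (X.clockwiseNext t)
      obtain ⟨m, hm⟩ := X.gap_spec t' (X.clockwiseNext t)
      have e : X.gap t t' = X.gap t (X.clockwiseNext t) - X.gap t' (X.clockwiseNext t) := by
        refine X.gap_eq (n := n - m) (by linarith) ?_ (by push_cast; linarith)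
        have := X.gap_le t (X.clockwiseNext t)
        have := X.gap_pos t' (X.clockwiseNext t)
        linarith
      have h1 := X.gap_clockwiseNext_le (t := t) (u := t') hsrc.symm
      have := X.gap_pos t' (X.clockwiseNext t)
      linarith
  intro t t' h
  rcases le_total (X.gap t' (X.clockwiseNext t')) (X.gap t (X.clockwiseNext t)) with hle | hle
  · exact key t t' h hle
  · exact (key t' t h.symm hle).symm

lemma clockwiseNext_ne [Finite S] {t u : S} (h : X.src u = X.src t) (hne : u ≠ t) :
    X.clockwiseNext t ≠ t := by
  intro heq
  have h1 := X.gap_clockwiseNext_le h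
  rw [heq] at h1
  have h2 : X.gap t t = 2 * Real.pi :=
    X.gap_eq (n := -1) Real.two_pi_pos le_rfl (by push_cast; ring)
  have h3 : X.gap t u = X.gap t t := le_antisymm (h2 ▸ X.gap_le t u) h1
  obtain ⟨n, hn⟩ := X.gap_spec t u
  rw [h3, h2] at hn
  have h4 : X.gap u t = X.gap t t := by
    rw [h2]
    exact X.gap_eq (n := - n - 2) Real.two_pi_pos le_rfl (by push_cast; linarith)
  exact hne (X.arg_dir_injOn h (X.arg_dir_eq_of_gap_eq h4))

/-- The directed segment that follows `s` on the boundary of the face to the left of `s`. -/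
noncomputable def faceNext [Finite S] (s : S) : S := X.clockwiseNext (X.rev s)

lemma faceNext_injective [Finite S] : Function.Injective X.faceNext :=
  X.clockwiseNext_injective.comp X.rev_injective

lemma src_faceNext [Finite S] (s : S) : X.src (X.faceNext s) = X.src (X.rev s) :=
  X.src_clockwiseNext _

/-- The open circular sector with centre `v`, radius `r` and angles between `a` and `b`. -/
def sector (v : ℂ) (r a b : ℝ) : Set ℂ :=
  (fun p : ℝ × ℝ => v + p.1 * Complex.exp (p.2 * Complex.I)) '' Set.Ioo 0 r ×ˢ Set.Ioo a b

lemma isPreconnected_sector (v : ℂ) (r a b : ℝ) : IsPreconnected (sector v r a b) :=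
  (isPreconnected_Ioo.prod isPreconnected_Ioo).image _ (by fun_prop)

lemma dir_eq_norm_mul_exp (s : S) :
    X.dir s = ‖X.dir s‖ * Complex.exp ((X.dir s).arg * Complex.I) :=
  (Complex.norm_mul_exp_arg_mul_I _).symm

lemma sector_notMem_seg [Finite S] {t t' : S} (h : X.src t' = X.src t) {r : ℝ} {q : ℂ}
    (hq : q ∈ sector (X.src t) r (X.dir (X.clockwiseNext t)).arg
      ((X.dir (X.clockwiseNext t)).arg + X.gap t (X.clockwiseNext t))) : q ∉ X.seg t' := by
  obtain ⟨⟨ρ, θ⟩, ⟨⟨hρ, -⟩, hθ0, hθ1⟩, rfl⟩ := hq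
  simp only at hρ hθ0 hθ1
  intro hq
  obtain ⟨τ, hτ, -, hτq⟩ := (X.mem_seg_iff _ _).1 hq
  rw [h, X.dir_eq_norm_mul_exp t'] at hτq
  simp only at hτq
  have e1 := add_left_cancel hτq
  have e2 := congrArg norm e1
  rw [← mul_assoc] at e1
  simp only [norm_mul, Complex.norm_real, Complex.norm_exp_ofReal_mul_I, Real.norm_eq_abs,
    abs_of_pos hρ, abs_of_nonneg hτ, mul_one, abs_norm] at e2
  have e3 : (τ : ℂ) * ‖X.dir t'‖ = ρ := by rw [e2]; push_cast; rfl
  rw [e3] at e1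
  have e4 := mul_left_cancel₀ (by exact_mod_cast hρ.ne') e1
  obtain ⟨n, hn⟩ := Complex.exp_eq_exp_iff_exists_int.1 e4
  have e5 : θ = (X.dir t').arg + n * (2 * Real.pi) := by
    have : ((θ : ℝ) : ℂ) = (((X.dir t').arg + n * (2 * Real.pi) : ℝ) : ℂ) := by
      refine mul_right_cancel₀ Complex.I_ne_zero (hn.trans ?_)
      push_cast; ring
    exact_mod_cast this
  obtain ⟨m, hm⟩ := X.gap_spec t (X.clockwiseNext t)
  have e6 : X.gap t t' =
      (X.dir (X.clockwiseNext t)).arg + X.gap t (X.clockwiseNext t) - θ := by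
    refine X.gap_eq (n := n + m) (by linarith) ?_ (by push_cast; linarith)
    have := X.gap_le t (X.clockwiseNext t)
    linarith
  have := X.gap_clockwiseNext_le h
  linarith

lemma exists_sector_disjoint [Finite S] (t : S) : ∃ r : ℝ, 0 < r ∧
    ∀ q ∈ sector (X.src t) r (X.dir (X.clockwiseNext t)).arg
      ((X.dir (X.clockwiseNext t)).arg + X.gap t (X.clockwiseNext t)), ∀ t', q ∉ X.seg t' := by
  have h1 : ∀ t', X.src t ∉ X.seg t' → ∀ᶠ r in 𝓝[>] (0 : ℝ),
      ∀ q ∈ Metric.ball (X.src t) r, q ∉ X.seg t' := by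
    intro t' h
    obtain ⟨δ, hδ, hb⟩ := Metric.isOpen_iff.1 (X.isCompact_seg t').isClosed.isOpen_compl _ h
    filter_upwards [Ioo_mem_nhdsGT hδ] with r hr q hq
    exact hb (Metric.ball_subset_ball hr.2.le hq)
  have h2 : ∀ᶠ r in 𝓝[>] (0 : ℝ), ∀ t', X.src t ∉ X.seg t' →
      ∀ q ∈ Metric.ball (X.src t) r, q ∉ X.seg t' :=
    eventually_all.2 fun t' => eventually_imp_distrib_left.2 (h1 t')
  obtain ⟨r, h3, h4⟩ := (h2.and self_mem_nhdsWithin).exists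
  refine ⟨r, h4, fun q hq t' => ?_⟩
  by_cases hv : X.src t ∈ X.seg t'
  · have hends : X.src t' = X.src t ∨ X.src (X.rev t') = X.src t := by
      rcases X.inter t t' _ (X.src_mem_seg t) hv with h | h | ⟨-, h⟩
      · exact Or.inl (by rw [h])
      · exact Or.inr (by rw [h, X.rev_rev])
      · rcases h with h | h
        · exact Or.inl h.symm
        · exact Or.inr h.symm
    rcases hends with h | h
    · exact X.sector_notMem_seg h hq
    · rw [← X.seg_rev]
      exact X.sector_notMem_seg h hq
  · refine h3 t' hv q ?_
    obtain ⟨⟨ρ, θ⟩, ⟨⟨hρ, hρr⟩, -⟩, rfl⟩ := hq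
    simp only at hρ hρr
    rw [Metric.mem_ball, dist_eq_norm]
    simpa [Complex.norm_exp_ofReal_mul_I, abs_of_pos hρ] using hρr

/-- Around the corner from `s` to the next segment of the face there is nothing to cross. -/
lemma exists_sector_meets [Finite S] {ε r : ℝ} (hε : 0 < ε) (hr : 0 < r) (s : S) :
    ∃ p ∈ X.leftTriangle ε s, ∃ q ∈ X.leftTriangle ε (X.faceNext s),
      p ∈ sector (X.src (X.rev s)) r (X.dir (X.faceNext s)).arg
        ((X.dir (X.faceNext s)).arg + X.gap (X.rev s) (X.faceNext s)) ∧
      q ∈ sector (X.src (X.rev s)) r (X.dir (X.faceNext s)).arg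
        ((X.dir (X.faceNext s)).arg + X.gap (X.rev s) (X.faceNext s)) := by
  set u := X.faceNext s with hu
  set g := X.gap (X.rev s) u with hg
  have hg0 : 0 < g := X.gap_pos _ _
  have h1 : ∀ᶠ η in 𝓝[>] (0 : ℝ), Real.sin η - ε * Real.cos η < 0 := by
    have hc : Continuous fun η : ℝ => Real.sin η - ε * Real.cos η := by fun_prop
    refine nhdsWithin_le_nhds ((hc.tendsto 0).eventually (gt_mem_nhds ?_))
    simp [hε]
  obtain ⟨η, ⟨hη1, hη2⟩, hη3⟩ := ((h1.and (Ioo_mem_nhdsGT hg0)).and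
    (Ioo_mem_nhdsGT Real.pi_pos)).exists
  have hsin : 0 < Real.sin η := Real.sin_pos_of_pos_of_lt_pi hη3.1 hη3.2
  have hcos : 0 < Real.cos η := by by_contra; nlinarith
  have hcos1 := Real.cos_le_one η
  have hsu : 0 < ‖X.dir u‖ := norm_pos_iff.2 (X.dir_ne_zero u)
  have hss : 0 < ‖X.dir s‖ := norm_pos_iff.2 (X.dir_ne_zero s)
  set ρ := min r (min ‖X.dir u‖ ‖X.dir s‖) / 2 with hρ
  have hρ0 : 0 < ρ := by positivity
  have hρr : ρ < r := by
    have : min r (min ‖X.dir u‖ ‖X.dir s‖) ≤ r := min_le_left _ _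
    linarith
  have hρu : ρ ≤ ‖X.dir u‖ / 2 := by
    have : min r (min ‖X.dir u‖ ‖X.dir s‖) ≤ ‖X.dir u‖ :=
      (min_le_right _ _).trans (min_le_left _ _)
    linarith
  have hρs : ρ ≤ ‖X.dir s‖ / 2 := by
    have : min r (min ‖X.dir u‖ ‖X.dir s‖) ≤ ‖X.dir s‖ :=
      (min_le_right _ _).trans (min_le_right _ _)
    linarith
  have hρu0 : 0 < ρ / ‖X.dir u‖ := by positivity
  have hρs0 : 0 < ρ / ‖X.dir s‖ := by positivity
  have hρu1 : ρ / ‖X.dir u‖ ≤ 1 / 2 := by rw [div_le_iff₀ hsu]; linarith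
  have hρs1 : ρ / ‖X.dir s‖ ≤ 1 / 2 := by rw [div_le_iff₀ hss]; linarith
  have hsuc : (‖X.dir u‖ : ℂ) ≠ 0 := by exact_mod_cast hsu.ne'
  have hssc : (‖X.dir s‖ : ℂ) ≠ 0 := by exact_mod_cast hss.ne'
  obtain ⟨n, hn⟩ := X.gap_spec (X.rev s) u
  refine ⟨X.src (X.rev s) + ρ * Complex.exp (((X.dir u).arg + g - η : ℝ) * Complex.I), ?_,
    X.src (X.rev s) + ρ * Complex.exp (((X.dir u).arg + η : ℝ) * Complex.I), ?_,
    ⟨(ρ, (X.dir u).arg + g - η), ⟨⟨hρ0, hρr⟩, by simp only; linarith [hη2.2],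
      by simp only; linarith [hη2.1]⟩, rfl⟩,
    ⟨(ρ, (X.dir u).arg + η), ⟨⟨hρ0, hρr⟩, by simp only; linarith [hη2.1],
      by simp only; linarith [hη2.2]⟩, rfl⟩⟩
  · refine ⟨1 - ρ / ‖X.dir s‖ * Real.cos η, ρ / ‖X.dir s‖ * Real.sin η, by positivity, ?_, ?_, ?_⟩
    · nlinarith
    · nlinarith
    · have hd := X.dir_eq_norm_mul_exp (X.rev s)
      rw [dir_rev, norm_neg] at hd
      have harg : ((-X.dir s).arg : ℝ) = (X.dir u).arg + g + n * (2 * Real.pi) := by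
        rw [← dir_rev]; linarith
      have hexp : Complex.exp (((-X.dir s).arg : ℝ) * Complex.I) =
          Complex.exp (((X.dir u).arg + g : ℝ) * Complex.I) := by
        rw [Complex.exp_eq_exp_iff_exists_int]
        exact ⟨n, by rw [harg]; push_cast; ring⟩
      rw [hexp] at hd
      have hsplit : Complex.exp (((X.dir u).arg + g - η : ℝ) * Complex.I) =
          Complex.exp (((X.dir u).arg + g : ℝ) * Complex.I) *
            (Real.cos η - Real.sin η * Complex.I) := by
        have : Complex.exp (-(η : ℂ) * Complex.I) = Real.cos η - Real.sin η * Complex.I := by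
          rw [Complex.exp_mul_I]; simp [sub_eq_add_neg]
        rw [← this, ← Complex.exp_add]
        congr 1
        push_cast; ring
      rw [hsplit, src_rev_eq]
      set E := Complex.exp (((X.dir u).arg + g : ℝ) * Complex.I)
      have hd' : X.dir s = -(‖X.dir s‖ * E) := by linear_combination -hd
      have : ((ρ / ‖X.dir s‖ : ℝ) : ℂ) * X.dir s = -(ρ * E) := by
        rw [Complex.ofReal_div]
        field_simp
        linear_combination ρ * hd'
      simp only [Complex.ofReal_sub, Complex.ofReal_mul, Complex.ofReal_one]
      linear_combination (Real.cos η - Real.sin η * Complex.I) * this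
  · refine ⟨ρ / ‖X.dir u‖ * Real.cos η, ρ / ‖X.dir u‖ * Real.sin η, by positivity, ?_, ?_, ?_⟩
    · nlinarith
    · nlinarith
    · have hd := X.dir_eq_norm_mul_exp u
      have hsplit : Complex.exp (((X.dir u).arg + η : ℝ) * Complex.I) =
          Complex.exp ((X.dir u).arg * Complex.I) *
            (Real.cos η + Real.sin η * Complex.I) := by
        have : Complex.exp ((η : ℂ) * Complex.I) = Real.cos η + Real.sin η * Complex.I := by
          rw [Complex.exp_mul_I]; simp
        rw [← this, ← Complex.exp_add]
        congr 1
        push_cast; ring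
      rw [hsplit, hu, src_faceNext, ← hu]
      set E := Complex.exp ((X.dir u).arg * Complex.I)
      have : ((ρ / ‖X.dir u‖ : ℝ) : ℂ) * X.dir u = ρ * E := by
        rw [Complex.ofReal_div]
        field_simp
        linear_combination ρ * hd
      simp only [Complex.ofReal_mul]
      linear_combination -(Real.cos η + Real.sin η * Complex.I) * this

/-- The planar duality between circulations and faces: twice a circulation is the coboundary of
the function that assigns to each directed segment the winding value of the face to its left. -/
theorem exists_face_potential [Fintype S] {z : S → ℤ} (hz : X.IsCirculation z) :
    ∃ w : S → ℤ, (∀ s, w (X.faceNext s) = w s) ∧ ∀ s, w s - w (X.rev s) = 2 * z s := by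
  obtain ⟨ε, hε, hdis⟩ := X.exists_leftTriangle_disjoint
  have hmem : ∀ s, X.leftPoint s (ε / 4) ∈ X.leftTriangle ε s := fun s =>
    X.leftPoint_mem (by positivity) (by linarith) s
  choose w hw using fun s => X.exists_winding_eq_intCast hz (hdis s · _ (hmem s))
  have hconst : ∀ s, ∀ q ∈ X.leftTriangle ε s, X.winding z q = w s := fun s q hq =>
    (X.winding_eq_of_isPreconnected hz (X.isPreconnected_leftTriangle ε s)
      (fun q hq t => hdis s t q hq) hq (hmem s)).trans (hw s)
  have hlim : ∀ s, ∀ᶠ y in 𝓝[>] (0 : ℝ), X.winding z (X.leftPoint s y) = w s := by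
    intro s
    filter_upwards [Ioo_mem_nhdsGT (half_pos hε)] with y hy
    exact hconst s _ (X.leftPoint_mem hy.1 hy.2 s)
  refine ⟨w, fun s => ?_, fun s => ?_⟩
  · obtain ⟨r, hr, hsec⟩ := X.exists_sector_disjoint (X.rev s)
    obtain ⟨p, hp, q, hq, hp', hq'⟩ := X.exists_sector_meets hε hr s
    have h1 := X.winding_eq_of_isPreconnected hz (isPreconnected_sector _ _ _ _) hsec hp' hq'
    rw [hconst _ _ hp, hconst _ _ hq] at h1
    exact_mod_cast h1.symm
  · have := X.winding_jump hz.rev s (hlim s) (hlim (X.rev s))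
    exact_mod_cast this

end SegmentSystem

/-! ### From a plane drawing to a segment system -/

/-- The conditions on the vertices `p 0, …, p (k + 1)` of a polygonal arc, in the complex plane. -/
structure IsPolyline (k : ℕ) (p : ℕ → ℂ) : Prop where
  ne : ∀ i, i ≤ k → p i ≠ p (i + 1)
  consecutive : ∀ i, i + 1 ≤ k →
    segment ℝ (p i) (p (i + 1)) ∩ segment ℝ (p (i + 1)) (p (i + 2)) = {p (i + 1)}
  disjoint : ∀ i j, i + 1 < j → j ≤ k →
    Disjoint (segment ℝ (p i) (p (i + 1))) (segment ℝ (p j) (p (j + 1)))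

namespace IsPolyline

variable {k : ℕ} {p : ℕ → ℂ}

lemma segment_reverse {i : ℕ} (hi : i ≤ k) :
    segment ℝ (p (k + 1 - i)) (p (k + 1 - (i + 1))) = segment ℝ (p (k - i)) (p (k - i + 1)) := by
  rw [segment_symm]
  congr 2 <;> omega

lemma reverse (h : IsPolyline k p) : IsPolyline k (fun i => p (k + 1 - i)) where
  ne i hi := by
    have e : k + 1 - i = (k - i) + 1 := by omega
    have e' : k + 1 - (i + 1) = k - i := by omega
    simp only [e, e']
    exact (h.ne (k - i) (by omega)).symm
  consecutive i hi := by
    have h1 := h.consecutive (k - (i + 1)) (by omega)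
    rw [segment_reverse (by omega), show i + 2 = (i + 1) + 1 by rfl, segment_reverse (by omega),
      Set.inter_comm]
    have e1 : k - (i + 1) + 1 = k - i := by omega
    have e2 : k - (i + 1) + 2 = k - i + 1 := by omega
    have e3 : k + 1 - (i + 1) = k - i := by omega
    rw [e1, e2] at h1
    rw [e1, e3, h1]
  disjoint i j hij hj := by
    rw [segment_reverse (by omega), segment_reverse (by omega)]
    exact (h.disjoint (k - j) (k - i) (by omega) (by omega)).symm

lemma ne_of_lt (h : IsPolyline k p) {i j : ℕ} (hij : i < j) (hj : j ≤ k + 1) : p i ≠ p j := by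
  intro heq
  obtain ⟨j, rfl⟩ : ∃ j', j = j' + 1 := ⟨j - 1, by omega⟩
  have h1 : p i ∈ segment ℝ (p i) (p (i + 1)) := left_mem_segment _ _ _
  have h2 : p i ∈ segment ℝ (p j) (p (j + 1)) := heq ▸ right_mem_segment _ _ _
  rcases Nat.lt_trichotomy j (i + 1) with h3 | rfl | h3
  · obtain rfl : j = i := by omega
    exact h.ne _ (by omega) heq
  · have h4 : p i ∈ ({p (i + 1)} : Set ℂ) := h.consecutive i (by omega) ▸ ⟨h1, h2⟩
    exact h.ne _ (by omega) h4
  · exact Set.disjoint_left.1 (h.disjoint i j h3 (by omega)) h1 h2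

lemma injOn (h : IsPolyline k p) {i j : ℕ} (hi : i ≤ k + 1) (hj : j ≤ k + 1) (heq : p i = p j) :
    i = j := by
  rcases Nat.lt_trichotomy i j with h1 | h1 | h1
  · exact absurd heq (h.ne_of_lt h1 hj)
  · exact h1
  · exact absurd heq.symm (h.ne_of_lt h1 hi)

lemma eq_of_mem_of_lt (h : IsPolyline k p) {i j : ℕ} (hij : i < j) (hj : j ≤ k) {q : ℂ}
    (h1 : q ∈ segment ℝ (p i) (p (i + 1))) (h2 : q ∈ segment ℝ (p j) (p (j + 1))) :
    q = p (i + 1) ∧ q = p j := by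
  rcases Nat.lt_or_ge (i + 1) j with h3 | h3
  · exact absurd h2 (Set.disjoint_left.1 (h.disjoint i j h3 hj) h1)
  · obtain rfl : j = i + 1 := by omega
    have h4 : q ∈ ({p (i + 1)} : Set ℂ) := h.consecutive i (by omega) ▸ ⟨h1, h2⟩
    exact ⟨h4, h4⟩

lemma eq_zero_of_start_mem (h : IsPolyline k p) {i : ℕ} (hi : i ≤ k)
    (hm : p 0 ∈ segment ℝ (p i) (p (i + 1))) : i = 0 := by
  by_contra h0
  have := h.eq_of_mem_of_lt (by omega : 0 < i) hi (left_mem_segment _ _ _) hm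
  exact h.ne_of_lt (by omega : 0 < i) (by omega) this.2

lemma eq_of_end_mem (h : IsPolyline k p) {i : ℕ} (hi : i ≤ k)
    (hm : p (k + 1) ∈ segment ℝ (p i) (p (i + 1))) : i = k := by
  by_contra h0
  have := h.eq_of_mem_of_lt (by omega : i < k) le_rfl hm (right_mem_segment _ _ _)
  exact h.ne_of_lt (by omega : i + 1 < k + 1) le_rfl this.1.symm

end IsPolyline

/-- A choice of polylines for the darts of a graph drawn in the complex plane, compatible with the
reversal of darts. -/
structure PolylineDrawing {V : Type u} (G : SimpleGraph V) where
  point : V → ℂ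
  point_injective : Function.Injective point
  /-- One less than the number of segments of the dart. -/
  len : G.Dart → ℕ
  /-- The vertices of the polyline of the dart. -/
  vert : G.Dart → ℕ → ℂ
  len_symm : ∀ d, len d.symm = len d
  vert_symm : ∀ d i, i ≤ len d + 1 → vert d.symm i = vert d (len d + 1 - i)
  vert_zero : ∀ d, vert d 0 = point d.fst
  isPolyline : ∀ d, IsPolyline (len d) (vert d)
  inter : ∀ d d' i j, i ≤ len d → j ≤ len d' → d' ≠ d → d' ≠ d.symm →
    ∀ q ∈ segment ℝ (vert d i) (vert d (i + 1)), q ∈ segment ℝ (vert d' j) (vert d' (j + 1)) →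
      ∃ x, (x = d.fst ∨ x = d.snd) ∧ (x = d'.fst ∨ x = d'.snd) ∧ q = point x
  point_mem : ∀ d i x, i ≤ len d → point x ∈ segment ℝ (vert d i) (vert d (i + 1)) →
    x = d.fst ∨ x = d.snd

lemma IsPolygonalArc.exists_isPolyline {x y : ℝ × ℝ} {A : Set (ℝ × ℝ)}
    (h : IsPolygonalArc x y A) : ∃ (k : ℕ) (p : ℕ → ℂ),
      p 0 = Complex.equivRealProdCLM.symm x ∧ p (k + 1) = Complex.equivRealProdCLM.symm y ∧
      IsPolyline k p ∧
      ∀ i, i ≤ k → segment ℝ (p i) (p (i + 1)) ⊆ Complex.equivRealProdCLM.symm '' A := by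
  obtain ⟨k, p, h0, h1, h2, h3, h4, rfl⟩ := h
  set T := Complex.equivRealProdCLM.symm with hT
  have hseg : ∀ a b : ℝ × ℝ, segment ℝ (T a) (T b) = T '' segment ℝ a b := fun a b =>
    (image_segment ℝ (T : (ℝ × ℝ) →ₗ[ℝ] ℂ).toAffineMap a b).symm
  have hinj : Function.Injective T := T.injective
  refine ⟨k, fun i => T (p i), by simp [h0], by simp [h1], ⟨?_, ?_, ?_⟩, ?_⟩
  · exact fun i hi h => h2 i hi (hinj h)
  · intro i hi
    simp only [hseg]
    rw [← Set.image_inter hinj, h3 i hi, Set.image_singleton]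
  · intro i j hij hj
    simp only [hseg]
    exact (Set.disjoint_image_iff hinj).2 (h4 i j hij hj)
  · intro i hi
    simp only [hseg]
    exact Set.image_mono (Set.subset_biUnion_of_mem (u := fun i => segment ℝ (p i) (p (i + 1)))
      (show i ∈ Set.Iic k from hi))

section

variable {V : Type u} {G : SimpleGraph V}

lemma SimpleGraph.Dart.fst_lt_snd_or [LinearOrder V] (d : G.Dart) :
    d.fst < d.snd ∨ d.snd < d.fst := lt_or_gt_of_ne d.fst_ne_snd

/-- Every plane drawing of a graph gives a compatible choice of polylines: take the polygonal arc
of an edge in the direction of a linear order on the vertices, and reverse it for the opposite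
dart. -/
lemma PlaneDrawing.exists_polylineDrawing (P : PlaneDrawing G) :
    Nonempty (PolylineDrawing G) := by
  classical
  let _ : LinearOrder V := linearOrderOfSTO WellOrderingRel
  set T := Complex.equivRealProdCLM.symm with hT
  have hex := fun d : G.Dart => (P.isPolygonalArc d.fst d.snd d.adj).exists_isPolyline
  choose k p hp0 hp1 hpl hsub using hex
  set len : G.Dart → ℕ := fun d => if d.fst < d.snd then k d else k d.symm with hlen
  set vert : G.Dart → ℕ → ℂ := fun d =>
    if d.fst < d.snd then p d else fun i => p d.symm (k d.symm + 1 - i) with hvert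
  have hpos : ∀ d : G.Dart, d.fst < d.snd → len d = k d ∧ vert d = p d := fun d h => by
    simp [hlen, hvert, h]
  have hneg : ∀ d : G.Dart, ¬ d.fst < d.snd →
      len d = k d.symm ∧ vert d = fun i => p d.symm (k d.symm + 1 - i) := fun d h => by
    simp [hlen, hvert, h]
  have hsymm : ∀ d : G.Dart, ¬ d.fst < d.snd → d.symm.fst < d.symm.snd := fun d h =>
    (d.fst_lt_snd_or).resolve_left h
  have hsymm' : ∀ d : G.Dart, d.fst < d.snd → ¬ d.symm.fst < d.symm.snd := fun d h =>
    not_lt_of_gt (show d.symm.snd < d.symm.fst from h)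
  have hmem : ∀ d i, i ≤ len d → segment ℝ (vert d i) (vert d (i + 1)) ⊆ T '' P.curve d.edge := by
    intro d i hi
    by_cases h : d.fst < d.snd
    · rw [(hpos d h).1] at hi
      rw [(hpos d h).2]
      exact hsub d i hi
    · rw [(hneg d h).1] at hi
      rw [(hneg d h).2]
      simp only
      rw [IsPolyline.segment_reverse hi, ← SimpleGraph.Dart.edge_symm]
      exact hsub d.symm _ (by omega)
  have hfs : ∀ (d : G.Dart) x, x ∈ d.edge ↔ x = d.fst ∨ x = d.snd := fun d x => by
    rw [show d.edge = s(d.fst, d.snd) from rfl, Sym2.mem_iff]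
  refine ⟨⟨fun x => T (P.point x), fun x y h => P.point_injective (T.injective h), len, vert,
    ?_, ?_, ?_, ?_, ?_, ?_⟩⟩
  · intro d
    by_cases h : d.fst < d.snd
    · rw [(hpos d h).1, (hneg _ (hsymm' d h)).1, SimpleGraph.Dart.symm_symm]
    · rw [(hneg d h).1, (hpos _ (hsymm d h)).1]
  · intro d i hi
    by_cases h : d.fst < d.snd
    · rw [(hpos d h).1, (hpos d h).2, (hneg _ (hsymm' d h)).2, SimpleGraph.Dart.symm_symm]
    · rw [(hneg d h).1] at hi ⊢
      rw [(hneg d h).2, (hpos _ (hsymm d h)).2]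
      simp only
      congr 1
      omega
  · intro d
    by_cases h : d.fst < d.snd
    · rw [(hpos d h).2, hp0]
    · rw [(hneg d h).2]
      simp only [Nat.sub_zero]
      rw [hp1]
      rfl
  · intro d
    by_cases h : d.fst < d.snd
    · rw [(hpos d h).1, (hpos d h).2]
      exact hpl d
    · rw [(hneg d h).1, (hneg d h).2]
      exact (hpl d.symm).reverse
  · intro d d' i j hi hj h1 h2 q hq hq'
    have he : d.edge ≠ d'.edge := fun h => by
      rcases SimpleGraph.dart_edge_eq_iff d' d |>.1 h.symm with h | h
      · exact h1 h
      · exact h2 h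
    obtain ⟨a, ha, rfl⟩ := hmem d i hi hq
    obtain ⟨b, hb, hab⟩ := hmem d' j hj hq'
    rw [T.injective hab] at hb
    obtain ⟨x, hx, hx', rfl⟩ := P.curve_inter_curve d.edge d.edge_mem d'.edge d'.edge_mem he a
      ⟨ha, hb⟩
    exact ⟨x, (hfs d x).1 hx, (hfs d' x).1 hx', rfl⟩
  · intro d i x hi hx
    obtain ⟨a, ha, hax⟩ := hmem d i hi hx
    rw [T.injective hax] at ha
    exact (hfs d x).1 (P.point_mem_curve d.edge d.edge_mem x ha)

end

namespace PolylineDrawing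

variable {V : Type u} {G : SimpleGraph V} (P : PolylineDrawing G)

lemma vert_last (d : G.Dart) : P.vert d (P.len d + 1) = P.point d.snd := by
  have h3 := P.vert_symm d 0 (by omega)
  rw [Nat.sub_zero, P.vert_zero] at h3
  exact h3.symm

lemma segment_symm (d : G.Dart) {i : ℕ} (hi : i ≤ P.len d) :
    segment ℝ (P.vert d.symm i) (P.vert d.symm (i + 1)) =
      segment ℝ (P.vert d (P.len d - i)) (P.vert d (P.len d - i + 1)) := by
  rw [P.vert_symm d i (by omega), P.vert_symm d (i + 1) (by omega)]
  exact IsPolyline.segment_reverse hi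

/-- The directed segments of the drawing: the segments of the polylines of all darts. -/
abbrev Piece : Type u := {s : G.Dart × ℕ // s.2 ≤ P.len s.1}

/-- A common point of a segment of a dart with a vertex of the graph is an end of the segment. -/
lemma eq_end_of_point_mem (d : G.Dart) {i : ℕ} (hi : i ≤ P.len d) {x : V}
    (hx : P.point x ∈ segment ℝ (P.vert d i) (P.vert d (i + 1))) :
    P.point x = P.vert d i ∨ P.point x = P.vert d (i + 1) := by
  rcases P.point_mem d i x hi hx with rfl | rfl
  · rw [← P.vert_zero] at hx ⊢
    obtain rfl := (P.isPolyline d).eq_zero_of_start_mem hi hx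
    exact Or.inl rfl
  · rw [← P.vert_last] at hx ⊢
    obtain rfl := (P.isPolyline d).eq_of_end_mem hi hx
    exact Or.inr rfl

lemma vert_inter_of_lt (d : G.Dart) {i j : ℕ} (hij : i < j) (hj : j ≤ P.len d) {q : ℂ}
    (h1 : q ∈ segment ℝ (P.vert d i) (P.vert d (i + 1)))
    (h2 : q ∈ segment ℝ (P.vert d j) (P.vert d (j + 1))) :
    q = P.vert d (i + 1) ∧ q = P.vert d j :=
  (P.isPolyline d).eq_of_mem_of_lt hij hj h1 h2

/-- The segment system formed by all segments of the drawing. -/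
def toSegmentSystem : SegmentSystem P.Piece where
  src s := P.vert s.1.1 s.1.2
  rev s := ⟨(s.1.1.symm, P.len s.1.1 - s.1.2), by simp only [P.len_symm]; omega⟩
  rev_rev := by
    rintro ⟨⟨d, i⟩, hi⟩
    apply Subtype.ext
    simp only at hi
    simp only [SimpleGraph.Dart.symm_symm, P.len_symm, Prod.mk.injEq, true_and]
    omega
  src_ne := by
    rintro ⟨⟨d, i⟩, hi⟩
    simp only at hi ⊢
    rw [P.vert_symm d _ (by omega), show P.len d + 1 - (P.len d - i) = i + 1 by omega]
    exact (P.isPolyline d).ne i hi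
  inter := by
    rintro ⟨⟨d, i⟩, hi⟩ ⟨⟨d', j⟩, hj⟩ q hq hq'
    simp only at hi hj hq hq' ⊢
    rw [P.vert_symm d _ (by omega), show P.len d + 1 - (P.len d - i) = i + 1 by omega] at hq ⊢
    rw [P.vert_symm d' _ (by omega), show P.len d' + 1 - (P.len d' - j) = j + 1 by omega] at hq' ⊢
    by_cases h1 : d' = d
    · subst h1
      rcases Nat.lt_trichotomy i j with h | rfl | h
      · have := P.vert_inter_of_lt _ h hj hq hq'
        exact Or.inr (Or.inr ⟨Or.inr this.1, Or.inl this.2⟩)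
      · exact Or.inl rfl
      · have := P.vert_inter_of_lt _ h hi hq' hq
        exact Or.inr (Or.inr ⟨Or.inl this.2, Or.inr this.1⟩)
    by_cases h2 : d' = d.symm
    · subst h2
      rw [P.len_symm] at hj
      rw [P.segment_symm d hj] at hq'
      have e1 : P.vert d.symm j = P.vert d (P.len d - j + 1) := by
        rw [P.vert_symm d j (by omega)]; congr 1; omega
      have e2 : P.vert d.symm (j + 1) = P.vert d (P.len d - j) := by
        rw [P.vert_symm d (j + 1) (by omega)]; congr 1; omega
      rw [e1, e2]
      rcases Nat.lt_trichotomy i (P.len d - j) with h | h | h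
      · have := P.vert_inter_of_lt _ h (by omega) hq hq'
        exact Or.inr (Or.inr ⟨Or.inr this.1, Or.inr this.2⟩)
      · refine Or.inr (Or.inl ?_)
        apply Subtype.ext
        simp only [Prod.mk.injEq, true_and]
        omega
      · have := P.vert_inter_of_lt _ h hi hq' hq
        exact Or.inr (Or.inr ⟨Or.inl this.2, Or.inl this.1⟩)
    · obtain ⟨x, -, -, rfl⟩ := P.inter d d' i j hi hj h1 h2 q hq hq'
      exact Or.inr (Or.inr ⟨P.eq_end_of_point_mem d hi hq, P.eq_end_of_point_mem d' hj hq'⟩)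

@[simp] lemma toSegmentSystem_src (s : P.Piece) :
    P.toSegmentSystem.src s = P.vert s.1.1 s.1.2 := rfl

instance [Finite V] : Finite P.Piece := by
  classical
  have : Finite G.Dart := Finite.of_injective _ (SimpleGraph.Dart.toProd_injective)
  refine Finite.of_injective (β := Σ d : G.Dart, Fin (P.len d + 1))
    (fun s => ⟨s.1.1, ⟨s.1.2, Nat.lt_succ_of_le s.2⟩⟩) ?_
  rintro ⟨⟨d, i⟩, hi⟩ ⟨⟨d', j⟩, hj⟩ h
  simp only [Sigma.mk.injEq] at h
  obtain ⟨rfl, h⟩ := h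
  rw [heq_iff_eq, Fin.mk.injEq] at h
  subst h
  rfl

/-- The first segment of a dart. -/
def first (d : G.Dart) : P.Piece := ⟨(d, 0), Nat.zero_le _⟩

/-- The last segment of a dart. -/
def last (d : G.Dart) : P.Piece := ⟨(d, P.len d), le_rfl⟩

lemma eq_first_of_src_eq_point {s : P.Piece} {x : V} (h : P.toSegmentSystem.src s = P.point x) :
    s = P.first s.1.1 ∧ s.1.1.fst = x := by
  obtain ⟨⟨d, i⟩, hi⟩ := s
  simp only [toSegmentSystem_src] at h hi ⊢
  have hi0 : i = 0 := by
    have hm : P.point x ∈ segment ℝ (P.vert d i) (P.vert d (i + 1)) := h ▸ left_mem_segment _ _ _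
    rcases P.point_mem d i x hi hm with rfl | rfl
    · rw [← P.vert_zero] at h
      exact (P.isPolyline d).injOn (by omega) (by omega) h
    · rw [← P.vert_last] at h
      have := (P.isPolyline d).injOn (by omega) (by omega) h
      omega
  subst hi0
  rw [P.vert_zero] at h
  exact ⟨rfl, P.point_injective h⟩

/-- At a bend of a polyline only the two segments of the bend start. -/
lemma eq_or_eq_of_src_eq_bend {s : P.Piece} {d : G.Dart} {i : ℕ} (hi : i + 1 ≤ P.len d)
    (h : P.toSegmentSystem.src s = P.vert d (i + 1)) :
    s = ⟨(d, i + 1), hi⟩ ∨ s = P.toSegmentSystem.rev ⟨(d, i), by simp only; omega⟩ := by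
  obtain ⟨⟨d', j⟩, hj⟩ := s
  simp only [toSegmentSystem_src] at h hj
  by_cases h1 : d' = d
  · subst h1
    have := (P.isPolyline d').injOn (by omega) (by omega) h
    subst this
    exact Or.inl rfl
  by_cases h2 : d' = d.symm
  · subst h2
    rw [P.len_symm] at hj
    rw [P.vert_symm d j (by omega)] at h
    have := (P.isPolyline d).injOn (by omega) (by omega) h
    refine Or.inr ?_
    apply Subtype.ext
    show (d.symm, j) = (d.symm, P.len d - i)
    rw [Prod.mk.injEq]
    exact ⟨rfl, by omega⟩
  · exfalso
    obtain ⟨x, hx, -, hq⟩ := P.inter d d' (i + 1) j hi hj h1 h2 (P.vert d (i + 1))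
      (left_mem_segment _ _ _) (h ▸ left_mem_segment _ _ _)
    rcases hx with rfl | rfl
    · rw [← P.vert_zero] at hq
      have := (P.isPolyline d).injOn (by omega) (by omega) hq
      omega
    · rw [← P.vert_last] at hq
      have := (P.isPolyline d).injOn (by omega) (by omega) hq
      omega

lemma src_rev_piece {d : G.Dart} {i : ℕ} (hi : i ≤ P.len d) :
    P.toSegmentSystem.src (P.toSegmentSystem.rev ⟨(d, i), hi⟩) = P.vert d (i + 1) := by
  show P.vert d.symm (P.len d - i) = _
  rw [P.vert_symm d _ (by omega)]
  congr 1
  omega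

lemma faceNext_bend [Finite V] {d : G.Dart} {i : ℕ} (hi : i + 1 ≤ P.len d) :
    P.toSegmentSystem.faceNext ⟨(d, i), by simp only; omega⟩ = ⟨(d, i + 1), hi⟩ := by
  have h := P.toSegmentSystem.src_faceNext ⟨(d, i), by simp only; omega⟩
  rw [P.src_rev_piece] at h
  rcases P.eq_or_eq_of_src_eq_bend hi h with h1 | h1
  · exact h1
  · exfalso
    refine P.toSegmentSystem.clockwiseNext_ne (t := P.toSegmentSystem.rev ⟨(d, i), by simp only; omega⟩)
      (u := ⟨(d, i + 1), hi⟩) ?_ ?_ h1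
    · rw [P.src_rev_piece]
      rfl
    · intro h2
      have h3 := congrArg (fun s : P.Piece => s.1.1) h2
      exact d.symm_ne h3.symm

lemma faceNext_last [Finite V] (d : G.Dart) :
    P.toSegmentSystem.faceNext (P.last d) =
        P.first (P.toSegmentSystem.faceNext (P.last d)).1.1 ∧
      (P.toSegmentSystem.faceNext (P.last d)).1.1.fst = d.snd := by
  apply P.eq_first_of_src_eq_point
  rw [P.toSegmentSystem.src_faceNext, last, P.src_rev_piece, P.vert_last]

/-- The next dart on the boundary of the face to the left of a dart. -/
noncomputable def faceNext [Finite V] (d : G.Dart) : G.Dart :=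
  (P.toSegmentSystem.faceNext (P.last d)).1.1

lemma faceNext_injective [Finite V] : Function.Injective P.faceNext := by
  intro d d' h
  have h1 : P.toSegmentSystem.faceNext (P.last d) = P.toSegmentSystem.faceNext (P.last d') := by
    rw [(P.faceNext_last d).1, (P.faceNext_last d').1]
    exact congrArg P.first h
  exact congrArg (fun s : P.Piece => s.1.1) (P.toSegmentSystem.faceNext_injective h1)

lemma isCirculation_lift [Fintype V] [DecidableEq V] [Fintype G.Dart] [Fintype P.Piece]
    {z : G.Dart → ℤ} (hz : ∀ d, z d.symm = - z d) (hv : ∀ v, (∑ d with d.fst = v, z d) = 0) :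
    P.toSegmentSystem.IsCirculation fun s => z s.1.1 := by
  classical
  refine ⟨fun s => hz s.1.1, fun p => ?_⟩
  by_cases hb : ∃ (d : G.Dart) (i : ℕ), i + 1 ≤ P.len d ∧ P.vert d (i + 1) = p
  · obtain ⟨d, i, hi, rfl⟩ := hb
    set a : P.Piece := ⟨(d, i + 1), hi⟩ with ha
    set b : P.Piece := P.toSegmentSystem.rev ⟨(d, i), by simp only; omega⟩ with hb
    have hab : a ≠ b := fun h => d.symm_ne (congrArg (fun s : P.Piece => s.1.1) h).symm
    have : (Finset.univ.filter fun s => P.toSegmentSystem.src s = P.vert d (i + 1)) = {a, b} := by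
      ext s
      simp only [Finset.mem_filter, Finset.mem_univ, true_and, Finset.mem_insert,
        Finset.mem_singleton]
      constructor
      · exact P.eq_or_eq_of_src_eq_bend hi
      · rintro (rfl | rfl)
        · rfl
        · exact P.src_rev_piece _
    rw [this, Finset.sum_pair hab]
    show z d + z d.symm = 0
    rw [hz]; ring
  · have h0 : ∀ s : P.Piece, P.toSegmentSystem.src s = p → s = P.first s.1.1 := by
      rintro ⟨⟨d, i⟩, hi⟩ h
      rcases i with _ | i
      · rfl
      · exact absurd ⟨d, i, hi, h⟩ hb
    by_cases hx : ∃ x, P.point x = p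
    · obtain ⟨x, rfl⟩ := hx
      rw [← hv x]
      refine Finset.sum_bij' (fun s _ => s.1.1) (fun d _ => P.first d) ?_ ?_ ?_ ?_ ?_
      · intro s hs
        simp only [Finset.mem_filter, Finset.mem_univ, true_and] at hs ⊢
        exact (P.eq_first_of_src_eq_point hs).2
      · intro d hd
        simp only [Finset.mem_filter, Finset.mem_univ, true_and] at hd ⊢
        show P.vert d 0 = _
        rw [P.vert_zero, hd]
      · intro s hs
        simp only [Finset.mem_filter, Finset.mem_univ, true_and] at hs
        exact (h0 s hs).symm
      · intro d hd
        rfl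
      · intro s hs
        rfl
    · apply Finset.sum_eq_zero
      intro s hs
      simp only [Finset.mem_filter, Finset.mem_univ, true_and] at hs
      exfalso
      apply hx
      refine ⟨s.1.1.fst, ?_⟩
      rw [← hs, h0 s hs, ← P.vert_zero]
      rfl

end PolylineDrawing

/-- The faces of a plane graph: a permutation of the darts that follows each dart by a dart starting
at its end, and such that each circulation is, up to the factor 2, the difference of a function on
the orbits between the two sides of an edge. -/
theorem IsPlanar.exists_face_permutation {V : Type u} [Fintype V] [DecidableEq V]
    {G : SimpleGraph V} [Fintype G.Dart] (hG : IsPlanar G) :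
    ∃ φ : Equiv.Perm G.Dart, (∀ d, (φ d).fst = d.snd) ∧
      ∀ z : G.Dart → ℤ, (∀ d, z d.symm = - z d) → (∀ v, (∑ d with d.fst = v, z d) = 0) →
        ∃ w : G.Dart → ℤ, (∀ d, w (φ d) = w d) ∧ ∀ d, w d - w d.symm = 2 * z d := by
  obtain ⟨D⟩ := hG
  obtain ⟨P⟩ := D.exists_polylineDrawing
  have : Fintype P.Piece := Fintype.ofFinite _
  refine ⟨Equiv.ofBijective P.faceNext
    (Finite.injective_iff_bijective.1 P.faceNext_injective), fun d => (P.faceNext_last d).2,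
    fun z hz hv => ?_⟩
  obtain ⟨w, hw, hwz⟩ := P.toSegmentSystem.exists_face_potential (P.isCirculation_lift hz hv)
  have hslide : ∀ d i (hi : i ≤ P.len d), w ⟨(d, i), hi⟩ = w (P.first d) := by
    intro d i
    induction i with
    | zero => intro _; rfl
    | succ i ih =>
      intro hi
      rw [← P.faceNext_bend hi, hw]
      exact ih (by omega)
  refine ⟨fun d => w (P.first d), fun d => ?_, fun d => ?_⟩
  · show w (P.first (P.toSegmentSystem.faceNext (P.last d)).1.1) = _
    rw [← (P.faceNext_last d).1, hw]
    exact hslide d _ _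
  · have h := hwz (P.first d)
    have h2 : w (P.toSegmentSystem.rev (P.first d)) = w (P.first d.symm) := hslide _ _ _
    rw [h2] at h
    exact h

/-! ### Circulations and the number of edges -/

namespace SimpleGraph

variable {V : Type u} {G : SimpleGraph V}

/-- An integer circulation on a graph: an antisymmetric function on the darts without net flow out
of any vertex. -/
structure IsCirculation [DecidableEq V] [Fintype G.Dart] (z : G.Dart → ℤ) : Prop where
  symm : ∀ d, z d.symm = - z d
  sum_fst : ∀ v, (∑ d with d.fst = v, z d) = 0

/-- The graph formed by the edges on which `z` does not vanish. -/
def supportGraph (z : G.Dart → ℤ) (hz : ∀ d, z d.symm = - z d) : SimpleGraph V where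
  Adj x y := ∃ h : G.Adj x y, z ⟨(x, y), h⟩ ≠ 0
  symm := ⟨fun x y ⟨h, h'⟩ => ⟨h.symm, by
    have := hz ⟨(x, y), h⟩
    intro h0
    apply h'
    have e : (⟨(x, y), h⟩ : G.Dart).symm = ⟨(y, x), h.symm⟩ := rfl
    rw [e, h0] at this
    omega⟩⟩
  loopless := ⟨fun x ⟨h, _⟩ => G.loopless.irrefl x h⟩

/-- No edge with nonzero flow is a bridge of the support, as there is no net flow across a cut. -/
lemma IsCirculation.not_isAcyclic [Fintype V] [DecidableEq V] [Fintype G.Dart] {z : G.Dart → ℤ}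
    (hz : G.IsCirculation z) (hne : z ≠ 0) : ¬ (supportGraph z hz.symm).IsAcyclic := by
  classical
  intro hac
  obtain ⟨d₀, hd₀⟩ : ∃ d, z d ≠ 0 := by
    by_contra h
    push Not at h
    exact hne (funext h)
  have hadj : (supportGraph z hz.symm).Adj d₀.fst d₀.snd := ⟨d₀.adj, hd₀⟩
  have hbr := isAcyclic_iff_forall_adj_isBridge.1 hac hadj
  rw [isBridge_iff] at hbr
  set H := (supportGraph z hz.symm).deleteEdges {s(d₀.fst, d₀.snd)} with hH
  set C : Finset V := Finset.univ.filter fun x => H.Reachable d₀.fst x with hC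
  have h1 : ∑ d with d.fst ∈ C, z d = 0 := by
    rw [← Finset.sum_fiberwise_of_maps_to (s := Finset.univ.filter fun d : G.Dart => d.fst ∈ C)
      (t := C) (g := fun d => d.fst) (fun d hd => (Finset.mem_filter.1 hd).2)]
    refine Finset.sum_eq_zero fun v hv => ?_
    rw [Finset.filter_filter, ← hz.sum_fst v]
    refine Finset.sum_congr (Finset.filter_congr fun d _ => ?_) fun _ _ => rfl
    constructor
    · exact fun h => h.2
    · exact fun h => ⟨by rw [h]; exact hv, h⟩
  have h2 : ∑ d with d.fst ∈ C ∧ d.snd ∈ C, z d = 0 := by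
    have h3 : ∑ d with d.fst ∈ C ∧ d.snd ∈ C, z d = ∑ d with d.fst ∈ C ∧ d.snd ∈ C, - z d := by
      refine Finset.sum_bij' (fun d _ => d.symm) (fun d _ => d.symm) ?_ ?_ ?_ ?_ ?_
      · intro d hd
        simp only [Finset.mem_filter, Finset.mem_univ, true_and] at hd ⊢
        exact ⟨hd.2, hd.1⟩
      · intro d hd
        simp only [Finset.mem_filter, Finset.mem_univ, true_and] at hd ⊢
        exact ⟨hd.2, hd.1⟩
      · intro d _; exact d.symm_symm
      · intro d _; exact d.symm_symm
      · intro d _; rw [hz.symm]; ring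
    rw [Finset.sum_neg_distrib] at h3
    omega
  have h4 : ∑ d with d.fst ∈ C ∧ d.snd ∉ C, z d = z d₀ := by
    have hv : d₀.snd ∉ C := by simpa [hC] using hbr
    have hu : d₀.fst ∈ C := by simp [hC]
    refine Finset.sum_eq_single_of_mem d₀ (by simp [hu, hv]) fun d hd hne => ?_
    simp only [Finset.mem_filter, Finset.mem_univ, true_and] at hd
    by_contra h0
    have hadj' : (supportGraph z hz.symm).Adj d.fst d.snd := ⟨d.adj, h0⟩
    by_cases he : s(d.fst, d.snd) = s(d₀.fst, d₀.snd)
    · rcases (dart_edge_eq_iff d d₀).1 he with h | h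
      · exact hne h
      · rw [h] at hd
        exact hv hd.1
    · apply hd.2
      have hr : H.Adj d.fst d.snd := by
        rw [hH, deleteEdges_adj]
        exact ⟨hadj', by simpa using he⟩
      have : H.Reachable d₀.fst d.fst := by simpa [hC] using hd.1
      simpa [hC] using this.trans hr.reachable
  have h5 := Finset.sum_filter_add_sum_filter_not
    (Finset.univ.filter fun d : G.Dart => d.fst ∈ C) (fun d => d.snd ∈ C) z
  rw [Finset.filter_filter, Finset.filter_filter, h1, h2, h4] at h5
  omega

/-- A set of darts that meets every edge carrying a nonzero circulation has at least as many
elements as the girth. -/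
lemma IsCirculation.le_card [Fintype V] [DecidableEq V] [Fintype G.Dart] {z : G.Dart → ℤ}
    (hz : G.IsCirculation z) (hne : z ≠ 0) {g : ℕ} (hg : (g : ℕ∞) ≤ G.egirth)
    {O : Finset G.Dart} (hO : ∀ d, z d ≠ 0 → d ∈ O ∨ d.symm ∈ O) : g ≤ O.card := by
  classical
  have hle : supportGraph z hz.symm ≤ G := fun x y h => h.1
  obtain ⟨a, c, hc, -⟩ := exists_egirth_eq_length.2 (hz.not_isAcyclic hne)
  have h1 := (le_egirth.1 hg) a (c.mapLe hle) (hc.mapLe hle)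
  rw [Walk.length_map] at h1
  have h2 : g ≤ c.length := by exact_mod_cast h1
  refine h2.trans ?_
  rw [← Walk.length_edges, ← List.toFinset_card_of_nodup hc.edges_nodup]
  refine (Finset.card_le_card (t := O.image Dart.edge) fun e he => ?_).trans Finset.card_image_le
  rw [List.mem_toFinset] at he
  have he' := c.edges_subset_edgeSet he
  induction e using Sym2.ind with
  | _ x y =>
    obtain ⟨h, hxy⟩ : (supportGraph z hz.symm).Adj x y := he'
    rw [Finset.mem_image]
    rcases hO _ hxy with h' | h'
    · exact ⟨_, h', rfl⟩
    · exact ⟨_, h', Dart.edge_symm _⟩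

section Orientation

variable [LinearOrder V]

/-- The darts directed from the smaller to the larger end: one for each edge. -/
abbrev UpDart (G : SimpleGraph V) : Type u := {d : G.Dart // d.fst < d.snd}

lemma Dart.symm_fst_lt_snd {d : G.Dart} (h : ¬ d.fst < d.snd) : d.symm.fst < d.symm.snd :=
  (lt_or_gt_of_ne d.fst_ne_snd).resolve_left h

/-- The antisymmetric function on darts with given values on the upward darts. -/
def antisymm (G : SimpleGraph V) : (UpDart G → ℤ) →ₗ[ℤ] (G.Dart → ℤ) where
  toFun x d := if h : d.fst < d.snd then x ⟨d, h⟩ else - x ⟨d.symm, Dart.symm_fst_lt_snd h⟩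
  map_add' x y := by
    ext d
    by_cases h : d.fst < d.snd
    · simp [h]
    · simp only [h, dite_false, Pi.add_apply]; ring
  map_smul' c x := by
    ext d
    by_cases h : d.fst < d.snd
    · simp [h]
    · simp [h]

lemma antisymm_apply (x : UpDart G → ℤ) (d : UpDart G) : antisymm G x d.1 = x d := by
  simp [antisymm, d.2]

lemma antisymm_symm (x : UpDart G → ℤ) (d : G.Dart) : antisymm G x d.symm = - antisymm G x d := by
  by_cases h : d.fst < d.snd
  · have h' : ¬ d.symm.fst < d.symm.snd := not_lt_of_gt (show d.symm.snd < d.symm.fst from h)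
    simp only [antisymm, LinearMap.coe_mk, AddHom.coe_mk, dif_pos h, dif_neg h', Dart.symm_symm]
  · have h' := Dart.symm_fst_lt_snd h
    simp only [antisymm, LinearMap.coe_mk, AddHom.coe_mk, dif_neg h, dif_pos h', neg_neg]

lemma antisymm_injective : Function.Injective (antisymm G) := fun x y h => by
  ext d
  rw [← antisymm_apply x, ← antisymm_apply y, h]

lemma card_dart_eq_two_mul_card_upDart [Fintype G.Dart] :
    Fintype.card G.Dart = 2 * Fintype.card (UpDart G) := by
  classical
  have h : Fintype.card {d : G.Dart // ¬ d.fst < d.snd} = Fintype.card (UpDart G) := by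
    refine Fintype.card_congr ⟨fun d => ⟨d.1.symm, Dart.symm_fst_lt_snd d.2⟩,
      fun d => ⟨d.1.symm, not_lt_of_gt (show d.1.symm.snd < d.1.symm.fst from d.2)⟩, ?_, ?_⟩
    · exact fun d => Subtype.ext (Dart.symm_symm _)
    · exact fun d => Subtype.ext (Dart.symm_symm _)
  rw [← Fintype.card_congr (Equiv.sumCompl fun d : G.Dart => d.fst < d.snd), Fintype.card_sum, h,
    two_mul]

/-- The net flow out of each vertex. -/
def netFlow (G : SimpleGraph V) [Fintype G.Dart] : (UpDart G → ℤ) →ₗ[ℤ] (V → ℤ) where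
  toFun x v := ∑ d with d.fst = v, antisymm G x d
  map_add' x y := by ext v; simp [Finset.sum_add_distrib]
  map_smul' c x := by
    ext v
    simp only [map_smul, Pi.smul_apply, Finset.smul_sum, RingHom.id_apply]

lemma isCirculation_antisymm [Fintype G.Dart] {x : UpDart G → ℤ} (hx : netFlow G x = 0) :
    G.IsCirculation (antisymm G x) :=
  ⟨antisymm_symm x, fun v => congrFun hx v⟩

lemma sum_netFlow [Fintype V] [Fintype G.Dart] (x : UpDart G → ℤ) : ∑ v, netFlow G x v = 0 := by
  have h1 : ∑ v, netFlow G x v = ∑ d, antisymm G x d :=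
    Finset.sum_fiberwise_of_maps_to (s := (Finset.univ : Finset G.Dart)) (t := Finset.univ)
      (g := fun d => d.fst) (fun _ _ => Finset.mem_univ _) (antisymm G x)
  have h2 : ∑ d, antisymm G x d = ∑ d, - antisymm G x d :=
    Fintype.sum_bijective Dart.symm (Function.Involutive.bijective Dart.symm_involutive) _ _
      fun d => by rw [antisymm_symm, neg_neg]
  rw [Finset.sum_neg_distrib] at h2
  omega

/-- The rank of the module of circulations is at least `|E| - |V| + 1`. -/
lemma card_upDart_add_one_le [Fintype V] [Nonempty V] [Fintype G.Dart] :
    Fintype.card (UpDart G) + 1 ≤ Module.finrank ℤ (netFlow G).ker + Fintype.card V := by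
  have rankNullity : ∀ {A B : Type u} [Fintype A] (f : (A → ℤ) →ₗ[ℤ] B → ℤ),
      Module.finrank ℤ f.range + Module.finrank ℤ f.ker = Fintype.card A := by
    intro A B _ f
    have h := Submodule.finrank_quotient_add_finrank f.ker
    rw [f.quotKerEquivRange.finrank_eq] at h
    simpa using h
  set σ : (V → ℤ) →ₗ[ℤ] (PUnit.{u + 1} → ℤ) :=
    LinearMap.pi fun _ => ∑ v, LinearMap.proj v with hσ
  have hσa : ∀ x i, σ x i = ∑ v, x v := fun x i => by simp [hσ]
  have h1 := rankNullity (netFlow G)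
  have h2 := rankNullity σ
  have h3 : σ.range = ⊤ := by
    rw [LinearMap.range_eq_top]
    intro y
    obtain ⟨v⟩ := ‹Nonempty V›
    refine ⟨Pi.single v (y PUnit.unit), ?_⟩
    ext i
    rw [hσa]
    simp
  have h4 : Module.finrank ℤ σ.range = 1 := by rw [h3]; simp
  have h5 : (netFlow G).range ≤ σ.ker := by
    rintro _ ⟨x, rfl⟩
    rw [LinearMap.mem_ker]
    ext i
    rw [hσa]
    exact sum_netFlow x
  have h6 := Submodule.finrank_mono h5
  omega

end Orientation

/-! ### Faces -/

section Faces

variable (φ : Equiv.Perm G.Dart)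

/-- The faces of a permutation of the darts: its orbits. -/
abbrev Face (φ : Equiv.Perm G.Dart) : Type u := Quotient (Equiv.Perm.SameCycle.setoid φ)

/-- The face to the left of a dart. -/
def faceOf (d : G.Dart) : Face φ := Quotient.mk _ d

lemma faceOf_apply (d : G.Dart) : faceOf φ (φ d) = faceOf φ d :=
  Quotient.sound (Equiv.Perm.sameCycle_apply_left.2 (Equiv.Perm.SameCycle.refl φ d))

lemma eq_of_faceOf_eq {φ : Equiv.Perm G.Dart} {w : G.Dart → ℤ} (hw : ∀ d, w (φ d) = w d)
    {d d' : G.Dart} (h : faceOf φ d = faceOf φ d') : w d = w d' := by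
  obtain ⟨n, rfl⟩ : φ.SameCycle d d' := Quotient.exact h
  have hnat : ∀ (n : ℕ) d, w ((φ ^ n) d) = w d := by
    intro n
    induction n with
    | zero => intro d; rfl
    | succ n ih => intro d; rw [pow_succ, Equiv.Perm.mul_apply, ih, hw]
  cases n with
  | ofNat n => exact (hnat n d).symm
  | negSucc n =>
    have := hnat (n + 1) ((φ ^ (Int.negSucc n)) d)
    rw [← this, ← Equiv.Perm.mul_apply, zpow_negSucc, mul_inv_cancel, Equiv.Perm.one_apply]

open Classical in
/-- The boundary of a face as a circulation: the face on the left counts positively. -/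
noncomputable def faceBoundary (F : Face φ) (d : G.Dart) : ℤ :=
  (if faceOf φ d = F then 1 else 0) - (if faceOf φ d.symm = F then 1 else 0)

lemma isCirculation_faceBoundary [DecidableEq V] [Fintype G.Dart] (hφ : ∀ d, (φ d).fst = d.snd) (F : Face φ) :
    G.IsCirculation (faceBoundary φ F) := by
  classical
  refine ⟨fun d => by simp only [faceBoundary, Dart.symm_symm]; ring, fun v => ?_⟩
  simp only [faceBoundary, Finset.sum_sub_distrib]
  rw [sub_eq_zero]
  refine Finset.sum_bij' (fun d _ => (φ.symm d).symm) (fun d _ => φ d.symm) ?_ ?_ ?_ ?_ ?_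
  · intro d hd
    simp only [Finset.mem_filter, Finset.mem_univ, true_and] at hd ⊢
    show (φ.symm d).snd = v
    rw [← hφ, Equiv.apply_symm_apply, hd]
  · intro d hd
    simp only [Finset.mem_filter, Finset.mem_univ, true_and] at hd ⊢
    rw [hφ]
    exact hd
  · intro d _; simp
  · intro d _; simp
  · intro d _
    rw [Dart.symm_symm, ← faceOf_apply φ (φ.symm d), Equiv.apply_symm_apply]

lemma sum_faceBoundary [Fintype (Face φ)] (w : Face φ → ℤ) (d : G.Dart) :
    ∑ F, w F * faceBoundary φ F d = w (faceOf φ d) - w (faceOf φ d.symm) := by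
  classical
  simp [faceBoundary, mul_sub, Finset.sum_sub_distrib]

end Faces

end SimpleGraph

open SimpleGraph in
/-- The edge bound of Euler's formula: `g (|E| - |V| + 2) ≤ 2 |E|` for a plane graph of girth at
least `g` with at least as many edges as vertices, written in terms of the number `2 |E|` of darts.
The boundaries of the faces generate twice the circulations and add up to zero, so at least
`|E| - |V| + 2` of them do not vanish; each of these has at least `g` darts. -/
theorem IsPlanar.girth_mul_card_dart_le {V : Type u} [Fintype V] [Nonempty V]
    {G : SimpleGraph V} [Fintype G.Dart] (hG : IsPlanar G) {g : ℕ} (hg : (g : ℕ∞) ≤ G.egirth)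
    (hE : 2 * Fintype.card V ≤ Fintype.card G.Dart) :
    g * Fintype.card G.Dart + 4 * g ≤ 2 * Fintype.card G.Dart + 2 * g * Fintype.card V := by
  classical
  let _ : LinearOrder V := linearOrderOfSTO WellOrderingRel
  obtain ⟨φ, hφ, hpot⟩ := hG.exists_face_permutation
  have : Fintype (Face φ) := Fintype.ofFinite _
  set B : Finset (Face φ) := Finset.univ.filter fun F => faceBoundary φ F ≠ 0 with hB
  have hcard := card_dart_eq_two_mul_card_upDart (G := G)
  have hrank := card_upDart_add_one_le (G := G)
  have hsum0 : ∑ F ∈ B, faceBoundary φ F = 0 := by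
    have h1 : ∑ F ∈ B, faceBoundary φ F = ∑ F, faceBoundary φ F := by
      refine Finset.sum_subset (Finset.subset_univ _) fun F _ hF => ?_
      by_contra h
      exact hF (by simp [hB, h])
    rw [h1]
    ext d
    have := sum_faceBoundary φ (fun _ => 1) d
    simpa using this
  -- twice a circulation is a combination of face boundaries
  have hspan : ∀ x ∈ (netFlow G).ker,
      (2 : ℤ) • antisymm G x ∈ Submodule.span ℤ (faceBoundary φ '' (B : Set (Face φ))) := by
    intro x hx
    have hc := isCirculation_antisymm (LinearMap.mem_ker.1 hx)
    obtain ⟨w, hw, hwz⟩ := hpot _ hc.symm hc.sum_fst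
    have h1 : (2 : ℤ) • antisymm G x =
        ∑ F, w (Quotient.out F) • faceBoundary φ F := by
      ext d
      rw [Pi.smul_apply, smul_eq_mul, ← hwz d, Finset.sum_apply]
      simp only [Pi.smul_apply, smul_eq_mul]
      rw [sum_faceBoundary φ (fun F => w (Quotient.out F)) d]
      congr 1 <;> exact eq_of_faceOf_eq hw (Quotient.out_eq _).symm
    rw [h1]
    refine Submodule.sum_mem _ fun F _ => Submodule.smul_mem _ _ ?_
    by_cases hF : faceBoundary φ F = 0
    · rw [hF]; exact Submodule.zero_mem _
    · exact Submodule.subset_span ⟨F, by simp [hB, hF], rfl⟩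
  have hfin : Module.finrank ℤ (netFlow G).ker ≤
      Module.finrank ℤ (Submodule.span ℤ (faceBoundary φ '' (B : Set (Face φ)))) := by
    set f : (netFlow G).ker →ₗ[ℤ] Submodule.span ℤ (faceBoundary φ '' (B : Set (Face φ))) :=
      LinearMap.codRestrict _ (((2 : ℤ) • antisymm G).comp (Submodule.subtype _))
        (fun x => hspan x.1 x.2) with hf
    refine LinearMap.finrank_le_finrank_of_injective (f := f) fun x y hxy => ?_
    have h1 := congrArg Subtype.val hxy
    have h2 : (2 : ℤ) • antisymm G x.1 = (2 : ℤ) • antisymm G y.1 := h1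
    exact Subtype.ext (antisymm_injective (smul_right_injective _ (by norm_num) h2))
  -- one of the nonzero face boundaries is redundant
  obtain ⟨F₀, hF₀⟩ : B.Nonempty := by
    rw [Finset.nonempty_iff_ne_empty]
    intro h
    rw [h, Finset.coe_empty, Set.image_empty, Submodule.span_empty, finrank_bot] at hfin
    omega
  have hredundant : Submodule.span ℤ (faceBoundary φ '' (B : Set (Face φ))) ≤
      Submodule.span ℤ (((B.erase F₀).image (faceBoundary φ) : Finset (G.Dart → ℤ)) :
        Set (G.Dart → ℤ)) := by
    rw [Submodule.span_le]
    rintro _ ⟨F, hF, rfl⟩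
    have hother : ∀ F ∈ B.erase F₀, faceBoundary φ F ∈
        Submodule.span ℤ (((B.erase F₀).image (faceBoundary φ) : Finset (G.Dart → ℤ)) :
          Set (G.Dart → ℤ)) := fun F hF =>
      Submodule.subset_span (Finset.mem_coe.2 (Finset.mem_image_of_mem _ hF))
    by_cases h : F = F₀
    · subst h
      have h2 := Finset.add_sum_erase B (faceBoundary φ) hF₀
      rw [hsum0] at h2
      rw [SetLike.mem_coe, eq_neg_of_add_eq_zero_left h2]
      exact Submodule.neg_mem _ (Submodule.sum_mem _ hother)
    · exact hother F (Finset.mem_erase.2 ⟨h, hF⟩)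
  have hB1 : Module.finrank ℤ (netFlow G).ker + 1 ≤ B.card := by
    have h1 := Submodule.finrank_mono hredundant
    have h2 := finrank_span_finset_le_card (R := ℤ) ((B.erase F₀).image (faceBoundary φ))
    have h3 : ((B.erase F₀).image (faceBoundary φ)).card ≤ (B.erase F₀).card :=
      Finset.card_image_le
    have h4 := Finset.card_erase_add_one hF₀
    have h5 := (hfin.trans h1).trans h2
    omega
  -- count the darts face by face
  have hcount : B.card * g ≤ Fintype.card G.Dart := by
    rw [← smul_eq_mul, ← Finset.card_univ (α := G.Dart)]
    have h1 : ∑ F ∈ B, (Finset.univ.filter fun d => faceOf φ d = F).card ≤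
        (Finset.univ : Finset G.Dart).card := by
      rw [Finset.card_eq_sum_card_fiberwise (s := (Finset.univ : Finset G.Dart))
        (t := (Finset.univ : Finset (Face φ))) (f := faceOf φ) (fun _ _ => Finset.mem_univ _)]
      exact Finset.sum_le_sum_of_subset (Finset.subset_univ _)
    refine le_trans (Finset.card_nsmul_le_sum _ _ _ fun F hF => ?_) h1
    refine (isCirculation_faceBoundary φ hφ F).le_card (Finset.mem_filter.1 hF).2 hg fun d hd => ?_
    simp only [Finset.mem_filter, Finset.mem_univ, true_and]
    by_contra h
    push Not at h
    exact hd (by simp [faceBoundary, h.1, h.2])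
  have h6 : (Fintype.card (UpDart G) + 2) * g ≤ (B.card + Fintype.card V) * g :=
    Nat.mul_le_mul_right _ (by omega)
  nlinarith

/-! ### Threads of vertices of degree two -/

namespace SimpleGraph

variable {V : Type u} {G : SimpleGraph V}

open Classical in
/-- A dart that leaves the end of `d` and does not turn back, if there is one; otherwise the
reverse of `d`. -/
noncomputable def onward (d : G.Dart) : G.Dart :=
  if h : ∃ e : G.Dart, e.fst = d.snd ∧ e ≠ d.symm then h.choose else d.symm

lemma onward_fst (d : G.Dart) : (onward d).fst = d.snd := by
  unfold onward
  split_ifs with h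
  · exact h.choose_spec.1
  · rfl

lemma onward_ne {d e : G.Dart} (h : e.fst = d.snd) (hne : e ≠ d.symm) : onward d ≠ d.symm := by
  have hex : ∃ e : G.Dart, e.fst = d.snd ∧ e ≠ d.symm := ⟨e, h, hne⟩
  unfold onward
  rw [dif_pos hex]
  exact hex.choose_spec.2

variable [Fintype V] [DecidableRel G.Adj]

/-- The number of consecutive vertices of degree two in front of a dart, cut off at `n`. -/
noncomputable def run (G : SimpleGraph V) [DecidableRel G.Adj] : ℕ → G.Dart → ℕ
  | 0, _ => 0
  | n + 1, d => if G.degree d.snd = 2 then run G n (onward d) + 1 else 0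

lemma run_succ_of_lt {n : ℕ} {d : G.Dart} (h : run G n d < n) : run G (n + 1) d = run G n d := by
  induction n generalizing d with
  | zero => omega
  | succ n ih =>
    rw [run] at h ⊢
    conv_rhs => rw [run]
    split_ifs with h2
    · rw [if_pos h2] at h
      rw [ih (by omega)]
    · rfl

lemma degree_of_le_run {n k : ℕ} {d : G.Dart} (h : k < run G n d) :
    G.degree (onward^[k] d).snd = 2 := by
  induction n generalizing k d with
  | zero => simp [run] at h
  | succ n ih =>
    rw [run] at h
    split_ifs at h with h2
    · rcases k with _ | k
      · exact h2
      · rw [Function.iterate_succ_apply]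
        exact ih (by omega)
    · omega

variable [DecidableEq V]

lemma card_filter_fst (v : V) :
    (Finset.univ.filter fun d : G.Dart => d.fst = v).card = G.degree v :=
  G.dart_fst_fiber_card_eq_degree v

lemma exists_dart_ne {v : V} (hv : 2 ≤ G.degree v) (d : G.Dart) :
    ∃ e : G.Dart, e.fst = v ∧ e ≠ d := by
  rw [← card_filter_fst] at hv
  obtain ⟨e, he, hne⟩ := Finset.exists_mem_ne (Nat.lt_of_succ_le hv) d
  exact ⟨e, (Finset.mem_filter.1 he).2, hne⟩

lemma onward_ne_symm {d : G.Dart} (h : 2 ≤ G.degree d.snd) : onward d ≠ d.symm := by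
  obtain ⟨e, he, hne⟩ := exists_dart_ne h d.symm
  exact onward_ne he hne

/-- Two different darts out of a vertex of degree two are all the darts out of it. -/
lemma eq_or_eq_of_degree_eq_two {v : V} (hv : G.degree v = 2) {a b c : G.Dart} (ha : a.fst = v)
    (hb : b.fst = v) (hc : c.fst = v) (hab : a ≠ b) : c = a ∨ c = b := by
  have h1 : ({a, b} : Finset G.Dart) = Finset.univ.filter fun d : G.Dart => d.fst = v := by
    refine Finset.eq_of_subset_of_card_le ?_ ?_
    · intro x hx
      rcases Finset.mem_insert.1 hx with rfl | hx
      · simp [ha]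
      · rw [Finset.mem_singleton.1 hx]; simp [hb]
    · rw [card_filter_fst, hv, Finset.card_pair hab]
  have h2 : c ∈ ({a, b} : Finset G.Dart) := by rw [h1]; simp [hc]
  simpa using h2

/-- The vertices of degree two are counted, once from each side, by the threads that start at the
other vertices. -/
lemma sum_run {n : ℕ} (hn : ∀ d : G.Dart, run G n d < n) :
    ∑ d : G.Dart with G.degree d.fst ≠ 2, run G n d =
      (Finset.univ.filter fun d : G.Dart => G.degree d.fst = 2).card := by
  have h1 : ∀ d : G.Dart, run G n d =
      if G.degree d.snd = 2 then run G n (onward d) + 1 else 0 := fun d => by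
    rw [← run_succ_of_lt (hn d), run]
  have h2 : ∑ d : G.Dart, run G n d =
      ∑ d : G.Dart with G.degree d.snd = 2, (run G n (onward d) + 1) := by
    rw [Finset.sum_filter]
    exact Finset.sum_congr rfl fun d _ => h1 d
  have hsnd : (Finset.univ.filter fun d : G.Dart => G.degree d.snd = 2).card =
      (Finset.univ.filter fun d : G.Dart => G.degree d.fst = 2).card := by
    refine Finset.card_bij' (fun d _ => d.symm) (fun d _ => d.symm) ?_ ?_ ?_ ?_
    · intro d hd
      simp only [Finset.mem_filter, Finset.mem_univ, true_and] at hd ⊢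
      exact hd
    · intro d hd
      simp only [Finset.mem_filter, Finset.mem_univ, true_and] at hd ⊢
      exact hd
    · intro d _; exact d.symm_symm
    · intro d _; exact d.symm_symm
  have h3 : ∑ d : G.Dart with G.degree d.snd = 2, run G n (onward d) =
      ∑ d : G.Dart with G.degree d.fst = 2, run G n d := by
    refine Finset.sum_bij (fun d _ => onward d) ?_ ?_ ?_ ?_
    · intro d hd
      simp only [Finset.mem_filter, Finset.mem_univ, true_and] at hd ⊢
      rwa [onward_fst]
    · intro d hd d' hd' heq
      simp only [Finset.mem_filter, Finset.mem_univ, true_and] at hd hd'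
      have hs : d'.snd = d.snd := by rw [← onward_fst, ← heq, onward_fst]
      rcases eq_or_eq_of_degree_eq_two hd (a := onward d) (b := d.symm) (c := d'.symm)
        (onward_fst d) rfl hs (onward_ne_symm hd.ge) with h | h
      · rw [heq] at h
        exact absurd h.symm (onward_ne_symm hd'.ge)
      · have := congrArg Dart.symm h
        rwa [Dart.symm_symm, Dart.symm_symm, eq_comm] at this
    · intro e he
      simp only [Finset.mem_filter, Finset.mem_univ, true_and] at he
      obtain ⟨e', he', hne⟩ := exists_dart_ne he.ge e
      have hd : G.degree e'.symm.snd = 2 := by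
        show G.degree e'.fst = 2
        rw [he', he]
      refine ⟨e'.symm, by simpa using hd, ?_⟩
      have h4 := onward_ne_symm hd.ge
      rw [Dart.symm_symm] at h4
      rcases eq_or_eq_of_degree_eq_two he (a := e) (b := e') (c := onward e'.symm) rfl he'
        ((onward_fst _).trans he') hne.symm with h | h
      · exact h
      · exact absurd h h4
    · intro d _; rfl
  have h4 := Finset.sum_filter_add_sum_filter_not (Finset.univ : Finset G.Dart)
    (fun d => G.degree d.fst = 2) (run G n)
  rw [h2, Finset.sum_add_distrib, h3, Finset.sum_const, smul_eq_mul, mul_one, hsnd] at h4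
  exact Nat.add_left_cancel h4

lemma sum_dart_eq {M : Type*} [AddCommMonoid M] (f : G.Dart → M) (p : V → Prop)
    [DecidablePred p] :
    ∑ d : G.Dart with p d.fst, f d = ∑ v with p v, ∑ d : G.Dart with d.fst = v, f d := by
  rw [← Finset.sum_fiberwise_of_maps_to (s := Finset.univ.filter fun d : G.Dart => p d.fst)
    (t := Finset.univ.filter p) (g := fun d => d.fst)
    (fun d hd => by simpa using hd)]
  refine Finset.sum_congr rfl fun v hv => ?_
  rw [Finset.filter_filter]
  refine Finset.sum_congr (Finset.filter_congr fun d _ => ?_) fun _ _ => rfl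
  simp only [Finset.mem_filter, Finset.mem_univ, true_and] at hv
  constructor
  · exact fun h => h.2
  · exact fun h => ⟨by rw [h]; exact hv, h⟩

end SimpleGraph

open SimpleGraph in
/-- Discharging: in a plane graph of girth at least `g` and minimum degree two without threads of
`n` vertices of degree two, some vertex of degree at least three sees more vertices of degree two
on its threads than its charge `(g - 2) deg - 2 g` pays for. A vertex of degree two has charge `-4`
and is paid `2` from each of the two ends of its thread. -/
theorem IsPlanar.exists_overcharged {V : Type u} [Fintype V] [Nonempty V] [DecidableEq V]
    {G : SimpleGraph V} [DecidableRel G.Adj] (hG : IsPlanar G) {g : ℕ} (hg : (g : ℕ∞) ≤ G.egirth)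
    (hg0 : 0 < g) (hmin : ∀ v, 2 ≤ G.degree v) {n : ℕ} (hn : ∀ d : G.Dart, run G n d < n) :
    ∃ v, 3 ≤ G.degree v ∧
      ((g : ℤ) - 2) * G.degree v - 2 * g < 2 * ∑ d : G.Dart with d.fst = v, (run G n d : ℤ) := by
  by_contra hcon
  push Not at hcon
  have hsum := G.dart_card_eq_sum_degrees
  have hE : 2 * Fintype.card V ≤ Fintype.card G.Dart := by
    rw [hsum, mul_comm, ← smul_eq_mul, ← Finset.card_univ]
    exact Finset.card_nsmul_le_sum _ _ _ fun v _ => hmin v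
  have hbound := hG.girth_mul_card_dart_le hg hE
  set c : V → ℤ := fun v => ((g : ℤ) - 2) * G.degree v - 2 * g with hc
  have htotal : ∑ v, c v < 0 := by
    have h1 : ∑ v, c v = ((g : ℤ) - 2) * Fintype.card G.Dart - 2 * g * Fintype.card V := by
      simp only [hc, Finset.sum_sub_distrib, ← Finset.mul_sum, Finset.sum_const, Finset.card_univ,
        nsmul_eq_mul]
      rw [hsum]
      push_cast
      ring
    rw [h1]
    have h2 : (g : ℤ) * Fintype.card G.Dart + 4 * g ≤
        2 * Fintype.card G.Dart + 2 * g * Fintype.card V := by exact_mod_cast hbound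
    have h3 : (0 : ℤ) < g := by exact_mod_cast hg0
    linarith
  have hsplit := Finset.sum_filter_add_sum_filter_not (Finset.univ : Finset V)
    (fun v => G.degree v = 2) c
  have htwo : ∑ v with G.degree v = 2, c v =
      -2 * ((Finset.univ.filter fun d : G.Dart => G.degree d.fst = 2).card : ℤ) := by
    have h1 : (((Finset.univ.filter fun d : G.Dart => G.degree d.fst = 2).card : ℕ) : ℤ) =
        ∑ v with G.degree v = 2, ∑ d : G.Dart with d.fst = v, (1 : ℤ) := by
      rw [← sum_dart_eq (fun _ => (1 : ℤ)) (fun v => G.degree v = 2)]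
      simp
    rw [h1, Finset.mul_sum]
    refine Finset.sum_congr rfl fun v hv => ?_
    have hv := (Finset.mem_filter.1 hv).2
    rw [Finset.sum_const, card_filter_fst, hc, hv]
    simp only [hv]
    push_cast
    ring
  have hother : 2 * ∑ d : G.Dart with G.degree d.fst ≠ 2, (run G n d : ℤ) ≤
      ∑ v with ¬ G.degree v = 2, c v := by
    rw [sum_dart_eq (fun d => (run G n d : ℤ)) (fun v => G.degree v ≠ 2), Finset.mul_sum]
    refine Finset.sum_le_sum fun v hv => hcon v ?_
    have := hmin v
    have := (Finset.mem_filter.1 hv).2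
    omega
  have hrun : ∑ d : G.Dart with G.degree d.fst ≠ 2, (run G n d : ℤ) =
      (Finset.univ.filter fun d : G.Dart => G.degree d.fst = 2).card := by
    exact_mod_cast sum_run hn
  rw [hrun] at hother
  linarith

namespace SimpleGraph

variable {V : Type u} {G : SimpleGraph V}

/-! ### Walks without turning back -/

lemma exists_walk_of_seq {H : SimpleGraph V} (n : ℕ) (x : ℕ → V)
    (h : ∀ i, i < n → H.Adj (x i) (x (i + 1))) :
    ∃ w : H.Walk (x 0) (x n), w.edges = (List.range n).map (fun i => s(x i, x (i + 1))) ∧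
      w.support = (List.range (n + 1)).map x := by
  induction n generalizing x with
  | zero => exact ⟨Walk.nil, by simp, by simp⟩
  | succ n ih =>
    obtain ⟨w, hw, hw'⟩ := ih (fun i => x (i + 1)) fun i hi => h (i + 1) (by omega)
    refine ⟨Walk.cons (h 0 (by omega)) w, ?_, ?_⟩
    · rw [Walk.edges_cons, hw, List.range_succ_eq_map, List.map_cons, List.map_map]
      rfl
    · rw [Walk.support_cons, hw', List.range_succ_eq_map (n := n + 1), List.map_cons, List.map_map]
      rfl

/-- A walk that never turns back and is shorter than the girth visits no vertex twice: its edges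
form an acyclic graph. -/
lemma injOn_of_nonbacktracking {g : ℕ} (hg : (g : ℕ∞) ≤ G.egirth) {n : ℕ} (hn : n < g) {x : ℕ → V}
    (hadj : ∀ i, i < n → G.Adj (x i) (x (i + 1))) (hne : ∀ i, i + 2 ≤ n → x i ≠ x (i + 2))
    {i j : ℕ} (hi : i ≤ n) (hj : j ≤ n) (heq : x i = x j) : i = j := by
  classical
  set E : Finset (Sym2 V) := (Finset.range n).image fun i => s(x i, x (i + 1)) with hE
  set H : SimpleGraph V := fromEdgeSet (E : Set (Sym2 V)) with hH
  have hHG : H ≤ G := by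
    intro a b hab
    rw [hH, fromEdgeSet_adj, Finset.mem_coe, hE, Finset.mem_image] at hab
    obtain ⟨⟨i, hi, h⟩, -⟩ := hab
    have := hadj i (Finset.mem_range.1 hi)
    rw [← mem_edgeSet, h] at this
    exact this
  have hHadj : ∀ i, i < n → H.Adj (x i) (x (i + 1)) := by
    intro i hi
    rw [hH, fromEdgeSet_adj]
    exact ⟨Finset.mem_coe.2 (Finset.mem_image_of_mem _ (Finset.mem_range.2 hi)), (hadj i hi).ne⟩
  have hac : H.IsAcyclic := by
    intro a c hc
    have h1 := (le_egirth.1 hg) a (c.mapLe hHG) (hc.mapLe hHG)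
    rw [Walk.length_map] at h1
    have h2 : g ≤ c.length := by exact_mod_cast h1
    have h3 : c.length ≤ n := by
      rw [← Walk.length_edges, ← List.toFinset_card_of_nodup hc.edges_nodup]
      refine (Finset.card_le_card (t := E) fun e he => ?_).trans
        (Finset.card_image_le.trans (Finset.card_range n).le)
      have := c.edges_subset_edgeSet (List.mem_toFinset.1 he)
      rw [hH, edgeSet_fromEdgeSet] at this
      exact this.1
    omega
  obtain ⟨w, hw, hw'⟩ := exists_walk_of_seq n x hHadj
  have hpath : w.IsPath := by
    rw [hac.isPath_iff_isChain, hw, List.isChain_map, List.isChain_range]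
    intro m hm h
    rcases Sym2.eq_iff.1 h with ⟨h, -⟩ | ⟨h, -⟩
    · exact (hadj m (by omega)).ne h
    · exact hne m (by omega) h
  have hnd := hpath.support_nodup
  rw [hw'] at hnd
  exact List.inj_on_of_nodup_map hnd (List.mem_range.2 (by omega)) (List.mem_range.2 (by omega)) heq

/-! ### Spiders -/

/-- The vertices on the thread that starts with the dart `d`. -/
noncomputable def thread (d : G.Dart) (i : ℕ) : V := (onward^[i] d).fst

lemma thread_zero (d : G.Dart) : thread d 0 = d.fst := rfl

lemma thread_succ (d : G.Dart) (i : ℕ) : thread d (i + 1) = (onward^[i] d).snd := by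
  rw [thread, Function.iterate_succ_apply', onward_fst]

lemma thread_adj (d : G.Dart) (i : ℕ) : G.Adj (thread d i) (thread d (i + 1)) := by
  rw [thread_succ]
  exact (onward^[i] d).adj

variable [Fintype V] [DecidableRel G.Adj]

/-- A spider: a vertex `v` together with, for each dart `d` out of `v`, a leg of `l d` vertices of
degree two. Two legs together are shorter than `g`. -/
structure IsSpider (G : SimpleGraph V) [DecidableRel G.Adj] (g : ℕ) (v : V) (l : G.Dart → ℕ) :
    Prop where
  degree_eq : ∀ d, d.fst = v → ∀ i, i < l d → G.degree (thread d (i + 1)) = 2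
  lt : ∀ d, d.fst = v → ∀ d', d'.fst = v → l d + l d' + 2 < g

namespace IsSpider

variable {g : ℕ} {v : V} {l : G.Dart → ℕ}

section

variable [DecidableEq V]

lemma thread_ne (h : G.IsSpider g v l) {d : G.Dart} (hd : d.fst = v) {i : ℕ} (hi : i < l d) :
    thread d i ≠ thread d (i + 2) := by
  have h1 := h.degree_eq d hd i hi
  rw [thread_succ] at h1
  have h2 := onward_ne_symm h1.ge
  intro h3
  apply h2
  apply Dart.ext
  apply Prod.ext
  · exact onward_fst _
  · show (onward (onward^[i] d)).snd = (onward^[i] d).fst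
    rw [← Function.iterate_succ_apply' onward i d, ← thread_succ]
    exact h3.symm

lemma eq_of_adj (h : G.IsSpider g v l) {d : G.Dart} (hd : d.fst = v) {i : ℕ} (hi : i < l d) {y : V}
    (hy : G.Adj (thread d (i + 1)) y) : y = thread d i ∨ y = thread d (i + 2) := by
  have h1 := h.degree_eq d hd i hi
  rcases eq_or_eq_of_degree_eq_two h1 (a := (onward^[i] d).symm) (b := onward (onward^[i] d))
    (c := ⟨(thread d (i + 1), y), hy⟩) (thread_succ d i).symm
    ((onward_fst _).trans (thread_succ d i).symm) rfl
    (onward_ne_symm (by rw [← thread_succ, h1])).symm with h2 | h2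
  · exact Or.inl (congrArg (fun e : G.Dart => e.snd) h2)
  · refine Or.inr ?_
    rw [thread_succ, Function.iterate_succ_apply']
    exact congrArg (fun e : G.Dart => e.snd) h2

lemma thread_injOn (h : G.IsSpider g v l) (hg : (g : ℕ∞) ≤ G.egirth) {d : G.Dart} (hd : d.fst = v)
    {i j : ℕ} (hi : i ≤ l d + 1) (hj : j ≤ l d + 1) (heq : thread d i = thread d j) : i = j := by
  have := h.lt d hd d hd
  exact injOn_of_nonbacktracking hg (n := l d + 1) (by omega) (fun i _ => thread_adj d i)
    (fun i hi => h.thread_ne hd (by omega)) hi hj heq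

/-- Different legs have no vertex in common except the center, including their end vertices. -/
lemma thread_ne_of_ne (h : G.IsSpider g v l) (hg : (g : ℕ∞) ≤ G.egirth) {d d' : G.Dart}
    (hd : d.fst = v) (hd' : d'.fst = v) (hne : d ≠ d') {i j : ℕ} (hi : i ≤ l d) (hj : j ≤ l d') :
    thread d (i + 1) ≠ thread d' (j + 1) := by
  intro heq
  set a := l d + 1 with ha
  -- walk in along the leg of `d` and out along the leg of `d'`
  set y : ℕ → V := fun k => if k ≤ a then thread d (a - k) else thread d' (k - a) with hy
  have hyl : ∀ k, k ≤ a → y k = thread d (a - k) := fun k hk => by simp [hy, hk]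
  have hyr : ∀ k, a ≤ k → y k = thread d' (k - a) := fun k hk => by
    rcases hk.eq_or_lt with rfl | hk
    · simp [hy, thread_zero, hd, hd']
    · simp [hy, not_le.2 hk]
  have hlt := h.lt d hd d' hd'
  have := injOn_of_nonbacktracking hg (n := l d + l d' + 2) hlt (x := y) ?_ ?_
    (i := a - (i + 1)) (j := a + (j + 1)) (by omega) (by omega) ?_
  · omega
  · intro k hk
    rcases Nat.lt_or_ge k a with hka | hka
    · rw [hyl k hka.le, hyl (k + 1) hka, show a - k = (a - (k + 1)) + 1 by omega]
      exact (thread_adj d _).symm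
    · rw [hyr k hka, hyr (k + 1) (by omega), show k + 1 - a = (k - a) + 1 by omega]
      exact thread_adj d' _
  · intro k hk
    rcases Nat.lt_or_ge (k + 1) a with hka | hka
    · rw [hyl k (by omega), hyl (k + 2) (by omega), show a - k = (a - (k + 2)) + 2 by omega]
      exact (h.thread_ne hd (by omega)).symm
    rcases Nat.lt_or_ge k a with hka' | hka'
    · rw [hyl k hka'.le, hyr (k + 2) (by omega), show a - k = 0 + 1 by omega,
        show k + 2 - a = 0 + 1 by omega, thread_succ, thread_succ]
      intro h2
      apply hne
      apply Dart.ext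
      exact Prod.ext (hd.trans hd'.symm) h2
    · rw [hyr k hka', hyr (k + 2) (by omega), show k + 2 - a = (k - a) + 2 by omega]
      exact h.thread_ne hd' (by omega)
  · rw [hyl _ (by omega), hyr _ (by omega), show a - (a - (i + 1)) = i + 1 by omega,
      show a + (j + 1) - a = j + 1 by omega]
    exact heq

/-- The positions on the legs of a spider determine the leg and the distance to the center. -/
lemma thread_eq_iff (h : G.IsSpider g v l) (hg : (g : ℕ∞) ≤ G.egirth) {d d' : G.Dart}
    (hd : d.fst = v) (hd' : d'.fst = v) {i j : ℕ} (hi : i ≤ l d) (hj : j ≤ l d')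
    (heq : thread d (i + 1) = thread d' (j + 1)) : d = d' ∧ i = j := by
  by_cases hne : d = d'
  · subst hne
    have := h.thread_injOn hg hd (by omega) (by omega) heq
    exact ⟨rfl, by omega⟩
  · exact absurd heq (h.thread_ne_of_ne hg hd hd' hne hi hj)

lemma thread_succ_ne_center (h : G.IsSpider g v l) (hg : (g : ℕ∞) ≤ G.egirth) {d : G.Dart}
    (hd : d.fst = v) {i : ℕ} (hi : i ≤ l d) : thread d (i + 1) ≠ v := by
  intro heq
  have := h.thread_injOn hg hd (i := i + 1) (j := 0) (by omega) (by omega)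
    (by rw [heq, thread_zero, hd])
  omega

end

/-- The center and the legs of a spider. -/
def body (v : V) (l : G.Dart → ℕ) : Set V :=
  {x | x = v ∨ ∃ d : G.Dart, d.fst = v ∧ ∃ i, i < l d ∧ thread d (i + 1) = x}

/-- A map on the vertices off a spider that respects the constraints `R` extends to the spider if
the constraints along the legs can be met with a common value at the center. -/
lemma exists_extension (h : G.IsSpider g v l) (hg : (g : ℕ∞) ≤ G.egirth) {W : Type v}
    {R : V → V → W → W → Prop} (hR : ∀ x y a b, R x y a b → R y x b a) {φ : V → W}
    (hφ : ∀ x y, x ∉ body v l → y ∉ body v l → G.Adj x y → R x y (φ x) (φ y)) {c : W}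
    {col : G.Dart → ℕ → W} (hc : ∀ d, d.fst = v → col d 0 = c)
    (hend : ∀ d, d.fst = v → col d (l d + 1) = φ (thread d (l d + 1)))
    (hcol : ∀ d, d.fst = v → ∀ i, i ≤ l d →
      R (thread d i) (thread d (i + 1)) (col d i) (col d (i + 1))) :
    ∃ ψ : V → W, ∀ x y, G.Adj x y → R x y (ψ x) (ψ y) := by
  classical
  set ψ : V → W := fun x => if x = v then c else
    if hx : ∃ p : G.Dart × ℕ, p.1.fst = v ∧ p.2 < l p.1 ∧ thread p.1 (p.2 + 1) = x then
      col hx.choose.1 (hx.choose.2 + 1) else φ x with hψ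
  have hψv : ψ v = c := by simp [hψ]
  have hψleg : ∀ d, d.fst = v → ∀ i, i ≤ l d + 1 → ψ (thread d i) = col d i := by
    intro d hd i hi
    rcases i with _ | i
    · rw [thread_zero, hd, hψv, hc d hd]
    have hnv := h.thread_succ_ne_center hg hd (i := i) (by omega)
    simp only [hψ, if_neg hnv]
    split_ifs with hx
    · obtain ⟨h1, h2, h3⟩ := hx.choose_spec
      obtain ⟨h4, h5⟩ := h.thread_eq_iff hg h1 hd h2.le (by omega) h3
      rw [h4, h5]
    · have hil : i = l d := by
        by_contra hne
        exact hx ⟨(d, i), hd, by simp only; omega, rfl⟩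
      subst hil
      exact (hend d hd).symm
  have hψoff : ∀ x, x ∉ body v l → ψ x = φ x := by
    intro x hx
    have h1 : x ≠ v := fun hxv => hx (Or.inl hxv)
    have h2 : ¬ ∃ p : G.Dart × ℕ, p.1.fst = v ∧ p.2 < l p.1 ∧ thread p.1 (p.2 + 1) = x := by
      rintro ⟨p, hp, hp', hp''⟩
      exact hx (Or.inr ⟨p.1, hp, p.2, hp', hp''⟩)
    simp only [hψ, if_neg h1, dif_neg h2]
  have hbody : ∀ x ∈ body v l, ∀ y, G.Adj x y → R x y (ψ x) (ψ y) := by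
    rintro x (rfl | ⟨d, hd, i, hi, rfl⟩) y hxy
    · have h1 := hcol ⟨(x, y), hxy⟩ rfl 0 (by omega)
      rw [← hψleg ⟨(x, y), hxy⟩ rfl 0 (by omega), ← hψleg ⟨(x, y), hxy⟩ rfl 1 (by omega)] at h1
      have hy : thread (⟨(x, y), hxy⟩ : G.Dart) 1 = y := thread_succ _ 0
      rw [zero_add, hy] at h1
      exact h1
    · rcases h.eq_of_adj hd hi hxy with rfl | rfl
      · apply hR
        rw [hψleg d hd i (by omega), hψleg d hd (i + 1) (by omega)]
        exact hcol d hd i (by omega)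
      · rw [hψleg d hd (i + 1) (by omega), hψleg d hd (i + 2) (by omega)]
        exact hcol d hd (i + 1) (by omega)
  refine ⟨ψ, fun x y hxy => ?_⟩
  by_cases hx : x ∈ body v l
  · exact hbody x hx y hxy
  by_cases hy : y ∈ body v l
  · exact hR _ _ _ _ (hbody y hy x hxy.symm)
  · rw [hψoff x hx, hψoff y hy]
    exact hφ x y hx hy hxy

end IsSpider

end SimpleGraph

/-! ### Colors reachable along a path -/

/-- The sets of colors that can be reached, from one color, along paths with `k` edges of prescribed
types; `N i a` is the set of colors that an edge of type `i` allows next to `a`. -/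
def reachSets {W ι : Type*} [Fintype W] [DecidableEq W] [Fintype ι] (N : ι → W → Finset W) :
    ℕ → Finset (Finset W)
  | 0 => Finset.univ.image fun c => {c}
  | k + 1 => (Finset.univ ×ˢ reachSets N k).image fun p : ι × Finset W => p.2.biUnion (N p.1)

/-- The colors from which a path with `k` edges can be completed to a given color at its far end
contain one of the sets in `reachSets N k`. -/
lemma exists_mem_reachSets {W ι V : Type*} [Fintype W] [DecidableEq W] [Fintype ι]
    {N : ι → W → Finset W} {R : V → V → W → W → Prop} (hR : ∀ x y a b, R x y a b → R y x b a)
    (k : ℕ) (x : ℕ → V) (hN : ∀ i, i < k → ∃ t, ∀ a, ∀ b ∈ N t a, R (x (i + 1)) (x i) a b)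
    (c : W) : ∃ A ∈ reachSets N k, ∀ a ∈ A, ∃ col : ℕ → W, col 0 = a ∧ col k = c ∧
      ∀ i, i < k → R (x i) (x (i + 1)) (col i) (col (i + 1)) := by
  induction k generalizing x with
  | zero =>
    refine ⟨{c}, by simp [reachSets], fun a ha => ⟨fun _ => c, ?_, rfl, by omega⟩⟩
    exact (Finset.mem_singleton.1 ha).symm
  | succ k ih =>
    obtain ⟨A, hA, hcol⟩ := ih (fun i => x (i + 1)) fun i hi => hN (i + 1) (by omega)
    obtain ⟨t, ht⟩ := hN 0 (by omega)
    refine ⟨A.biUnion (N t), ?_, fun a ha => ?_⟩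
    · rw [reachSets, Finset.mem_image]
      exact ⟨(t, A), Finset.mem_product.2 ⟨Finset.mem_univ _, hA⟩, rfl⟩
    · obtain ⟨b, hb, hab⟩ := Finset.mem_biUnion.1 ha
      obtain ⟨col, h0, hk, hc⟩ := hcol b hb
      refine ⟨fun i => Nat.casesOn i a col, rfl, hk, fun i hi => ?_⟩
      rcases i with _ | i
      · exact hR _ _ _ _ (by simpa [h0] using ht b a hab)
      · exact hc i (by omega)

/-! ### Homomorphisms of plane graphs of large girth -/

/-- Induced subgraphs of planar graphs are planar. -/
lemma IsPlanar.induce {V : Type u} {G : SimpleGraph V} (hG : IsPlanar G) (S : Set V) :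
    IsPlanar (G.induce S) := by
  obtain ⟨P⟩ := hG
  have hedge : ∀ e : Sym2 S, e ∈ (G.induce S).edgeSet → e.map Subtype.val ∈ G.edgeSet := by
    intro e
    induction e using Sym2.ind with
    | _ x y => exact fun h => h
  have hmem : ∀ (e : Sym2 S) (x : S), x.1 ∈ e.map Subtype.val → x ∈ e := by
    intro e x hx
    obtain ⟨y, hy, hyx⟩ := Sym2.mem_map.1 hx
    rwa [← Subtype.ext hyx]
  refine ⟨⟨fun x => P.point x, fun e => P.curve (e.map Subtype.val), ?_, ?_, ?_, ?_⟩⟩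
  · exact P.point_injective.comp Subtype.val_injective
  · exact fun x y h => P.isPolygonalArc x y h
  · exact fun e he x hx => hmem e x (P.point_mem_curve _ (hedge e he) x hx)
  · intro e he f hf hef q hq
    obtain ⟨x, hx, hx', rfl⟩ := P.curve_inter_curve _ (hedge e he) _ (hedge f hf)
      (fun h => hef (Sym2.map.injective Subtype.val_injective h)) q hq
    obtain ⟨y, hy, rfl⟩ := Sym2.mem_map.1 hx
    exact ⟨y, hy, hmem f y hx', rfl⟩

lemma SimpleGraph.le_egirth_induce {V : Type u} {G : SimpleGraph V} {g : ℕ∞} (hg : g ≤ G.egirth)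
    (S : Set V) : g ≤ (G.induce S).egirth := by
  rw [SimpleGraph.le_egirth]
  intro a c hc
  have h := (SimpleGraph.le_egirth.1 hg) _ _
    (hc.map (f := (SimpleGraph.Embedding.induce S).toHom) Subtype.val_injective)
  rwa [SimpleGraph.Walk.length_map] at h

namespace SimpleGraph

/-- A map that respects the constraints off a spider exists on the whole graph if sets of colors
reachable along the legs always have a common color at the center. -/
lemma IsSpider.exists_map {V : Type u} {G : SimpleGraph V} [Fintype V] [DecidableRel G.Adj]
    {g : ℕ} {v : V} {l : G.Dart → ℕ} (h : G.IsSpider g v l) (hg : (g : ℕ∞) ≤ G.egirth)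
    {W ι : Type*} [Fintype W] [DecidableEq W] [Fintype ι] {N : ι → W → Finset W}
    {R : V → V → W → W → Prop} (hR : ∀ x y a b, R x y a b → R y x b a)
    (hN : ∀ x y, G.Adj x y → ∃ t, ∀ a, ∀ b ∈ N t a, R x y a b)
    (hex : ∃ φ : V → W, ∀ x y, x ∉ IsSpider.body v l → y ∉ IsSpider.body v l → G.Adj x y →
      R x y (φ x) (φ y))
    (hreach : ∀ A : G.Dart → Finset W, (∀ d, d.fst = v → A d ∈ reachSets N (l d + 1)) →
      ∃ c, ∀ d, d.fst = v → c ∈ A d) :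
    ∃ ψ : V → W, ∀ x y, G.Adj x y → R x y (ψ x) (ψ y) := by
  obtain ⟨φ, hφ⟩ := hex
  choose A hA hcol using fun d : G.Dart => exists_mem_reachSets (N := N) hR (l d + 1) (thread d)
    (fun i _ => hN _ _ (thread_adj d i).symm) (φ (thread d (l d + 1)))
  obtain ⟨c, hc⟩ := hreach A fun d _ => hA d
  have hcol' : ∀ d : G.Dart, ∃ col : ℕ → W, d.fst = v → col 0 = c ∧
      col (l d + 1) = φ (thread d (l d + 1)) ∧
      ∀ i, i < l d + 1 → R (thread d i) (thread d (i + 1)) (col i) (col (i + 1)) := by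
    intro d
    by_cases hd : d.fst = v
    · obtain ⟨col, hcol⟩ := hcol d c (hc d hd)
      exact ⟨col, fun _ => hcol⟩
    · exact ⟨fun _ => c, fun h => absurd h hd⟩
  choose col hcol using hcol'
  exact h.exists_extension hg hR hφ (fun d hd => (hcol d hd).1) (fun d hd => (hcol d hd).2.1)
    (fun d hd i hi => (hcol d hd).2.2 i (by omega))

end SimpleGraph

open SimpleGraph in
/-- If sets of reachable colors intersect as required, every plane graph of girth at least `g` has a
map that respects the constraints: a smallest graph without such a map contains no vertex of
degree at most one, no thread of `b + 1` vertices of degree two and no vertex of degree three that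
sees `s` vertices of degree two, and so contradicts the discharging argument. A vertex of degree
three has charge `g - 6`, which pays for up to `s - 1` vertices of degree two by `hs`; a vertex of
larger degree can pay for `b` vertices on each of its threads by `hb`. -/
theorem exists_map_of_reachSets {W ι : Type*} [Fintype W] [DecidableEq W] [Nonempty W] [Fintype ι]
    {N : ι → W → Finset W} {g b s : ℕ} (hs : 2 * s + 4 ≤ g) (hb : 4 * b + 4 ≤ g)
    (hone : ∀ A ∈ reachSets N 1, A.Nonempty)
    (htwo : ∀ A ∈ reachSets N 1, ∀ B ∈ reachSets N (b + 1), (A ∩ B).Nonempty)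
    (hthree : ∀ i j k, i ≤ b → j ≤ b → k ≤ b → i + j + k = s → ∀ A ∈ reachSets N (i + 1),
      ∀ B ∈ reachSets N (j + 1), ∀ C ∈ reachSets N (k + 1), (A ∩ (B ∩ C)).Nonempty)
    {V : Type u} [Finite V] {G : SimpleGraph V} (hG : IsPlanar G) (hg : (g : ℕ∞) ≤ G.egirth)
    {R : V → V → W → W → Prop} (hR : ∀ x y a b, R x y a b → R y x b a)
    (hN : ∀ x y, G.Adj x y → ∃ t, ∀ a, ∀ b ∈ N t a, R x y a b) :
    ∃ φ : V → W, ∀ x y, G.Adj x y → R x y (φ x) (φ y) := by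
  classical
  induction hn : Nat.card V using Nat.strong_induction_on generalizing V with
  | _ n ih =>
  subst hn
  have : Fintype V := Fintype.ofFinite V
  rcases isEmpty_or_nonempty V with hV | hV
  · exact ⟨fun x => hV.elim x, fun x => hV.elim x⟩
  -- the body of a spider contains its center, so the complement is smaller
  have hoff : ∀ (v : V) (l : G.Dart → ℕ), ∃ φ : V → W, ∀ x y, x ∉ IsSpider.body v l →
      y ∉ IsSpider.body v l → G.Adj x y → R x y (φ x) (φ y) := by
    intro v l
    set S : Set V := (IsSpider.body v l)ᶜ with hS
    have hlt : Nat.card S < Nat.card V := by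
      rw [Nat.card_eq_fintype_card, Nat.card_eq_fintype_card]
      exact Fintype.card_subtype_lt (x := v) fun h => h (Or.inl rfl)
    obtain ⟨φ, hφ⟩ := ih _ hlt (hG.induce S) (le_egirth_induce hg S)
      (R := fun x y => R x y) (fun x y a b => hR x y a b) (fun x y h => hN x y h) rfl
    refine ⟨fun x => if h : x ∈ S then φ ⟨x, h⟩ else Classical.arbitrary W, fun x y hx hy hxy => ?_⟩
    simp only [dif_pos (show x ∈ S from hx), dif_pos (show y ∈ S from hy)]
    exact hφ ⟨x, hx⟩ ⟨y, hy⟩ hxy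
  have hspider : ∀ (v : V) (l : G.Dart → ℕ), G.IsSpider g v l →
      (∀ A : G.Dart → Finset W, (∀ d, d.fst = v → A d ∈ reachSets N (l d + 1)) →
        ∃ c, ∀ d, d.fst = v → c ∈ A d) →
      ∃ φ : V → W, ∀ x y, G.Adj x y → R x y (φ x) (φ y) := fun v l h hreach =>
    h.exists_map hg hR hN (hoff v l) hreach
  by_cases hmin : ∀ v, 2 ≤ G.degree v
  swap
  · push Not at hmin
    obtain ⟨v, hv⟩ := hmin
    refine hspider v (fun _ => 0) ⟨fun d _ i hi => absurd hi (by omega), fun _ _ _ _ => by omega⟩ ?_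
    intro A hA
    rw [← card_filter_fst] at hv
    by_cases hd : ∃ d : G.Dart, d.fst = v
    · obtain ⟨d, hd⟩ := hd
      obtain ⟨c, hc⟩ := hone _ (hA d hd)
      refine ⟨c, fun d' hd' => ?_⟩
      have : d' = d := Finset.card_le_one.1 (Nat.le_of_lt_succ hv) d' (by simp [hd']) d
        (by simp [hd])
      rwa [this]
    · exact ⟨Classical.arbitrary W, fun d hd' => absurd ⟨d, hd'⟩ hd⟩
  by_cases hrun : ∀ d : G.Dart, run G (b + 1) d < b + 1
  swap
  · -- a long thread is a spider with its first vertex of degree two as center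
    push Not at hrun
    obtain ⟨d, hd⟩ := hrun
    have hdeg : ∀ k, k < b + 1 → G.degree (onward^[k] d).snd = 2 := fun k hk =>
      degree_of_le_run (lt_of_lt_of_le hk hd)
    have hd0 : G.degree d.snd = 2 := hdeg 0 (by omega)
    have hne : onward d ≠ d.symm := onward_ne_symm hd0.ge
    have hcases : ∀ e : G.Dart, e.fst = d.snd → e = d.symm ∨ e = onward d := fun e he =>
      eq_or_eq_of_degree_eq_two hd0 rfl (onward_fst d) he hne.symm
    refine hspider d.snd (fun e => if e = onward d then b else 0) ⟨?_, ?_⟩ ?_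
    · intro e he i hi
      rcases hcases e he with rfl | rfl
      · rw [if_neg hne.symm] at hi
        omega
      · rw [if_pos rfl] at hi
        rw [thread_succ, ← Function.iterate_succ_apply]
        exact hdeg (i + 1) (by omega)
    · intro e _ e' _
      split_ifs <;> omega
    · intro A hA
      have h1 := hA d.symm rfl
      have h2 := hA (onward d) (onward_fst d)
      rw [if_neg hne.symm] at h1
      rw [if_pos rfl] at h2
      obtain ⟨c, hc⟩ := htwo _ h1 _ h2
      rw [Finset.mem_inter] at hc
      refine ⟨c, fun e he => ?_⟩
      rcases hcases e he with rfl | rfl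
      · exact hc.1
      · exact hc.2
  obtain ⟨v, hv3, hv⟩ := hG.exists_overcharged hg (by omega) hmin hrun
  have hrunb : ∀ d : G.Dart, run G (b + 1) d ≤ b := fun d => Nat.le_of_lt_succ (hrun d)
  have hdeg3 : G.degree v = 3 := by
    by_contra hne
    have h4 : (4 : ℤ) ≤ G.degree v := by exact_mod_cast (by omega : 4 ≤ G.degree v)
    have h5 : ∑ d : G.Dart with d.fst = v, (run G (b + 1) d : ℤ) ≤ G.degree v * b := by
      rw [← card_filter_fst, ← nsmul_eq_mul]
      exact Finset.sum_le_card_nsmul _ _ _ fun d _ => by exact_mod_cast hrunb d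
    have hb' : (4 * b + 4 : ℤ) ≤ g := by exact_mod_cast hb
    nlinarith
  rw [hdeg3] at hv
  obtain ⟨d₁, d₂, d₃, h12, h13, h23, hfil⟩ := Finset.card_eq_three.1
    ((card_filter_fst (G := G) v).trans hdeg3)
  have hmem : ∀ d : G.Dart, d.fst = v ↔ d = d₁ ∨ d = d₂ ∨ d = d₃ := fun d => by
    have : d ∈ Finset.univ.filter (fun d : G.Dart => d.fst = v) ↔ d ∈ ({d₁, d₂, d₃} : Finset _) := by
      rw [hfil]
    simpa using this
  rw [hfil, Finset.sum_insert (by simp [h12, h13]), Finset.sum_pair h23] at hv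
  have hsum : s ≤ run G (b + 1) d₁ + run G (b + 1) d₂ + run G (b + 1) d₃ := by
    have hs' : (2 * s + 4 : ℤ) ≤ g := by exact_mod_cast hs
    push_cast at hv
    omega
  -- shorten the legs to a total of exactly `s` vertices
  obtain ⟨i, j, k, hi, hj, hk, hijk⟩ : ∃ i j k, i ≤ run G (b + 1) d₁ ∧ j ≤ run G (b + 1) d₂ ∧
      k ≤ run G (b + 1) d₃ ∧ i + j + k = s :=
    ⟨min (run G (b + 1) d₁) s, min (run G (b + 1) d₂) (s - min (run G (b + 1) d₁) s),
      s - min (run G (b + 1) d₁) s - min (run G (b + 1) d₂) (s - min (run G (b + 1) d₁) s),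
      by omega, by omega, by omega, by omega⟩
  set l : G.Dart → ℕ := fun d => if d = d₁ then i else if d = d₂ then j else k with hl
  have hl1 : l d₁ = i := by simp [hl]
  have hl2 : l d₂ = j := by simp [hl, h12.symm]
  have hl3 : l d₃ = k := by simp [hl, h13.symm, h23.symm]
  have hlrun : ∀ d, d.fst = v → l d ≤ run G (b + 1) d := by
    intro d hd
    rcases (hmem d).1 hd with rfl | rfl | rfl
    · rw [hl1]; exact hi
    · rw [hl2]; exact hj
    · rw [hl3]; exact hk
  refine hspider v l ⟨fun d hd m hm => ?_, fun d hd d' hd' => ?_⟩ fun A hA => ?_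
  · rw [thread_succ]
    exact degree_of_le_run (lt_of_lt_of_le hm (hlrun d hd))
  · have := (hlrun d hd).trans (hrunb d)
    have := (hlrun d' hd').trans (hrunb d')
    omega
  · have h1 := hA d₁ ((hmem _).2 (by simp))
    have h2 := hA d₂ ((hmem _).2 (by simp))
    have h3 := hA d₃ ((hmem _).2 (by simp))
    rw [hl1] at h1
    rw [hl2] at h2
    rw [hl3] at h3
    obtain ⟨c, hc⟩ := hthree i j k (hi.trans (hrunb _)) (hj.trans (hrunb _)) (hk.trans (hrunb _))
      hijk _ h1 _ h2 _ h3
    simp only [Finset.mem_inter] at hc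
    refine ⟨c, fun d hd => ?_⟩
    rcases (hmem d).1 hd with rfl | rfl | rfl
    · exact hc.1
    · exact hc.2.1
    · exact hc.2.2

/-! ### Straight-line drawings -/

/-- Twice the signed area of the triangle `a b c`. -/
def cross {K : Type*} [CommRing K] (a b c : K × K) : K :=
  (b.1 - a.1) * (c.2 - a.2) - (b.2 - a.2) * (c.1 - a.1)

lemma cross_segment {a b c d q : ℝ × ℝ} (hq : q ∈ segment ℝ c d) :
    ∃ t : ℝ, 0 ≤ t ∧ t ≤ 1 ∧ q = c + t • (d - c) ∧
      cross a b q = (1 - t) * cross a b c + t * cross a b d := by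
  rw [segment_eq_image'] at hq
  obtain ⟨t, ⟨h0, h1⟩, rfl⟩ := hq
  refine ⟨t, h0, h1, rfl, ?_⟩
  simp only [cross, Prod.fst_add, Prod.snd_add, Prod.smul_fst, Prod.smul_snd, Prod.fst_sub,
    Prod.snd_sub, smul_eq_mul]
  ring

lemma cross_eq_zero_of_mem_segment {a b q : ℝ × ℝ} (hq : q ∈ segment ℝ a b) :
    cross a b q = 0 := by
  obtain ⟨t, -, -, -, h⟩ := cross_segment (a := a) (b := b) hq
  rw [h]
  simp only [cross]
  ring

lemma disjoint_segment_of_cross {a b c d : ℝ × ℝ} (h : 0 < cross a b c * cross a b d) :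
    Disjoint (segment ℝ a b) (segment ℝ c d) := by
  refine Set.disjoint_left.2 fun q hq hq' => ?_
  have h1 := cross_eq_zero_of_mem_segment hq
  obtain ⟨t, h0, ht, -, h2⟩ := cross_segment (a := a) (b := b) hq'
  rw [h1] at h2
  rcases pos_and_pos_or_neg_and_neg_of_mul_pos h with ⟨h3, h4⟩ | ⟨h3, h4⟩
  · rcases h0.eq_or_lt with rfl | h0
    · linarith
    · have := mul_pos h0 h4
      have := mul_nonneg (sub_nonneg.2 ht) h3.le
      linarith
  · rcases h0.eq_or_lt with rfl | h0
    · linarith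
    · have := mul_neg_of_pos_of_neg h0 h4
      have := mul_nonpos_of_nonneg_of_nonpos (sub_nonneg.2 ht) h3.le
      linarith

lemma eq_of_mem_segment_of_cross_ne_zero {a b d q : ℝ × ℝ} (h : cross a b d ≠ 0)
    (hq : q ∈ segment ℝ a b) (hq' : q ∈ segment ℝ a d) : q = a := by
  have h1 := cross_eq_zero_of_mem_segment hq
  obtain ⟨t, -, -, h2, h3⟩ := cross_segment (a := a) (b := b) hq'
  have h4 : cross a b a = 0 := by simp [cross]
  rw [h1, h4, mul_zero, zero_add, eq_comm, mul_eq_zero] at h3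
  rcases h3 with rfl | h3
  · simpa using h2
  · exact absurd h3 h

/-- The curve of an edge in the straight-line drawing with given vertices. -/
def straightCurve {V : Type u} (p : V → ℝ × ℝ) : Sym2 V → Set (ℝ × ℝ) :=
  Sym2.lift ⟨fun x y => segment ℝ (p x) (p y), fun x y => segment_symm ℝ (p x) (p y)⟩

/-- A graph is planar if its vertices can be placed on integer points in general position such that
disjoint edges are separated: one of them lies strictly on one side of the line through the
other. -/
theorem isPlanar_of_straight {V : Type u} {G : SimpleGraph V} (p : V → ℤ × ℤ)
    (hinj : Function.Injective p)
    (hgen : ∀ a b c, a ≠ b → a ≠ c → b ≠ c → cross (p a) (p b) (p c) ≠ 0)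
    (hsep : ∀ a b c d, G.Adj a b → G.Adj c d → a ≠ c → a ≠ d → b ≠ c → b ≠ d →
      0 < cross (p a) (p b) (p c) * cross (p a) (p b) (p d) ∨
        0 < cross (p c) (p d) (p a) * cross (p c) (p d) (p b)) :
    IsPlanar G := by
  set P : V → ℝ × ℝ := fun x => ((p x).1, (p x).2) with hP
  have hcross : ∀ a b c, cross (P a) (P b) (P c) = (cross (p a) (p b) (p c) : ℤ) := fun a b c => by
    simp only [cross, hP]
    push_cast
    ring
  have hPinj : Function.Injective P := fun x y h => hinj (by
    have h1 := congrArg Prod.fst h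
    have h2 := congrArg Prod.snd h
    simp only [hP, Int.cast_inj] at h1 h2
    exact Prod.ext h1 h2)
  have hgen' : ∀ a b c, a ≠ b → a ≠ c → b ≠ c → cross (P a) (P b) (P c) ≠ 0 :=
    fun a b c h1 h2 h3 => by
      rw [hcross]
      exact_mod_cast hgen a b c h1 h2 h3
  refine ⟨⟨P, straightCurve P, hPinj, ?_, ?_, ?_⟩⟩
  · intro x y hxy
    refine ⟨0, fun i => if i = 0 then P x else P y, rfl, rfl, ?_, ?_, ?_, ?_⟩
    · intro i hi
      obtain rfl : i = 0 := by omega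
      exact fun h => hxy.ne (hPinj h)
    · intro i hi
      omega
    · intro i j hij hj
      omega
    · ext q
      simp [straightCurve]
  · intro e
    induction e using Sym2.ind with
    | _ a b =>
      intro hab x hx
      have hab : G.Adj a b := hab
      by_contra hne
      rw [Sym2.mem_iff, not_or] at hne
      exact hgen' a b x hab.ne (Ne.symm hne.1) (Ne.symm hne.2) (cross_eq_zero_of_mem_segment hx)
  · intro e he f hf hef q
    induction e using Sym2.ind with
    | _ a b =>
    induction f using Sym2.ind with
    | _ c d =>
    rintro ⟨hq, hq'⟩
    have hab : G.Adj a b := he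
    have hcd : G.Adj c d := hf
    have hq : q ∈ segment ℝ (P a) (P b) := hq
    have hq' : q ∈ segment ℝ (P c) (P d) := hq'
    have key : ∀ a b d, G.Adj a b → G.Adj a d → s(a, b) ≠ s(a, d) →
        q ∈ segment ℝ (P a) (P b) → q ∈ segment ℝ (P a) (P d) → q = P a := by
      intro a b d hab had hne h1 h2
      refine eq_of_mem_segment_of_cross_ne_zero (hgen' a b d hab.ne had.ne ?_) h1 h2
      rintro rfl
      exact hne rfl
    by_cases hac : a = c
    · subst hac
      exact ⟨a, by simp, by simp, key a b d hab hcd hef hq hq'⟩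
    by_cases had : a = d
    · subst had
      refine ⟨a, by simp, by simp, key a b c hab hcd.symm ?_ hq (segment_symm ℝ (P c) (P a) ▸ hq')⟩
      rwa [Sym2.eq_swap (a := a) (b := c)]
    by_cases hbc : b = c
    · subst hbc
      refine ⟨b, by simp, by simp, key b a d hab.symm hcd ?_ (segment_symm ℝ (P a) (P b) ▸ hq) hq'⟩
      rwa [Sym2.eq_swap (a := b) (b := a)]
    by_cases hbd : b = d
    · subst hbd
      refine ⟨b, by simp, by simp, key b a c hab.symm hcd.symm ?_
        (segment_symm ℝ (P a) (P b) ▸ hq) (segment_symm ℝ (P c) (P b) ▸ hq')⟩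
      rwa [Sym2.eq_swap (a := b) (b := a), Sym2.eq_swap (a := b) (b := c)]
    · exfalso
      rcases hsep a b c d hab hcd hac had hbc hbd with h | h
      · refine Set.disjoint_left.1 (disjoint_segment_of_cross ?_) hq hq'
        rw [hcross, hcross]
        exact_mod_cast h
      · refine Set.disjoint_left.1 (disjoint_segment_of_cross ?_) hq' hq
        rw [hcross, hcross]
        exact_mod_cast h

namespace ColoredMixedGraph

/-! ### The two target graphs -/

/-- The universality criterion for a target graph `T`, in terms of the sets `N t a` of vertices of
`T` joined to `a` by an arc out of `a` (`t = inl (i, true)`), an arc into `a` (`t = inl (i, false)`)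
or an edge (`t = inr j`) of a given color. -/
theorem isPlanarUniversal_of_reachSets {m n : ℕ} {W : Type v} [Fintype W] [DecidableEq W]
    [Nonempty W] {T : ColoredMixedGraph m n W} {N : (Fin m × Bool) ⊕ Fin n → W → Finset W}
    (hout : ∀ i a, ∀ b ∈ N (.inl (i, true)) a, T.arc i a b)
    (hin : ∀ i a, ∀ b ∈ N (.inl (i, false)) a, T.arc i b a)
    (hedge : ∀ j a, ∀ b ∈ N (.inr j) a, T.edge j a b)
    {g b s : ℕ} (hs : 2 * s + 4 ≤ g) (hb : 4 * b + 4 ≤ g)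
    (hone : ∀ A ∈ reachSets N 1, A.Nonempty)
    (htwo : ∀ A ∈ reachSets N 1, ∀ B ∈ reachSets N (b + 1), (A ∩ B).Nonempty)
    (hthree : ∀ i j k, i ≤ b → j ≤ b → k ≤ b → i + j + k = s → ∀ A ∈ reachSets N (i + 1),
      ∀ B ∈ reachSets N (j + 1), ∀ C ∈ reachSets N (k + 1), (A ∩ (B ∩ C)).Nonempty) :
    IsPlanarUniversal.{u} g T := by
  intro V _ G ⟨hG, hg⟩
  set R : V → V → W → W → Prop := fun x y a b =>
    (∀ i, (G.arc i x y → T.arc i a b) ∧ (G.arc i y x → T.arc i b a)) ∧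
      ∀ j, G.edge j x y → T.edge j a b with hR
  have hsymm : ∀ x y a b, R x y a b → R y x b a := fun x y a b h =>
    ⟨fun i => ⟨(h.1 i).2, (h.1 i).1⟩,
      fun j hj => T.edge_symm _ _ _ (h.2 j (G.edge_symm _ _ _ hj))⟩
  have hN : ∀ x y, G.underlying.Adj x y → ∃ t, ∀ a, ∀ b ∈ N t a, R x y a b := by
    rintro x y (⟨i, h | h⟩ | ⟨j, h⟩)
    · refine ⟨.inl (i, true), fun a b hab => ⟨fun i' => ⟨fun h' => ?_, fun h' => ?_⟩,
        fun j h' => absurd h' (G.arc_not_edge _ _ _ _ h)⟩⟩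
      · rw [G.arc_unique _ _ _ _ h' h]
        exact hout i a b hab
      · exact absurd h' (G.arc_asymm _ _ _ _ h)
    · refine ⟨.inl (i, false), fun a b hab => ⟨fun i' => ⟨fun h' => ?_, fun h' => ?_⟩,
        fun j h' => absurd (G.edge_symm _ _ _ h') (G.arc_not_edge _ _ _ _ h)⟩⟩
      · exact absurd h' (G.arc_asymm _ _ _ _ h)
      · rw [G.arc_unique _ _ _ _ h' h]
        exact hin i a b hab
    · refine ⟨.inr j, fun a b hab => ⟨fun i => ⟨fun h' => ?_, fun h' => ?_⟩, fun j' h' => ?_⟩⟩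
      · exact absurd h (G.arc_not_edge _ _ _ _ h')
      · exact absurd (G.edge_symm _ _ _ h) (G.arc_not_edge _ _ _ _ h')
      · rw [G.edge_unique _ _ _ _ h' h]
        exact hedge j a b hab
  obtain ⟨φ, hφ⟩ := exists_map_of_reachSets hs hb hone htwo hthree hG hg hsymm hN
  refine ⟨φ, fun i x y h => ?_, fun j x y h => ?_⟩
  · exact ((hφ x y (Or.inl ⟨i, Or.inl h⟩)).1 i).1 h
  · exact (hφ x y (Or.inr ⟨j, h⟩)).2 j h

/-- Every choice of one set from each of three families has a common element. -/
abbrev Intersecting {W : Type*} [DecidableEq W] (X Y Z : Finset (Finset W)) : Prop :=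
  ∀ A ∈ X, ∀ B ∈ Y, ∀ C ∈ Z, (A ∩ (B ∩ C)).Nonempty

lemma Intersecting.swap {W : Type*} [DecidableEq W] {X Y Z : Finset (Finset W)}
    (h : Intersecting X Y Z) : Intersecting Y X Z := fun A hA B hB C hC => by
  rw [Finset.inter_left_comm]
  exact h B hB A hA C hC

lemma Intersecting.rotate {W : Type*} [DecidableEq W] {X Y Z : Finset (Finset W)}
    (h : Intersecting X Y Z) : Intersecting Y Z X := fun A hA B hB C hC => by
  rw [← Finset.inter_assoc, Finset.inter_comm]
  exact h C hC A hA B hB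

/-- The out-neighbors and in-neighbors in `T5`. -/
def nbrT5 : (Fin 1 × Bool) ⊕ Fin 0 → Fin 5 → Finset (Fin 5)
  | .inl (_, true) => ![{1, 2}, {2, 3, 4}, {3}, {0, 4}, {0}]
  | .inl (_, false) => ![{3, 4}, {0}, {0, 1}, {1, 2}, {1, 3}]
  | .inr _ => fun _ => ∅

/-- The blue neighbors and red neighbors in `T6`. -/
def nbrT6 : (Fin 0 × Bool) ⊕ Fin 2 → Fin 6 → Finset (Fin 6)
  | .inl _ => fun _ => ∅
  | .inr 0 => ![{1, 2, 5}, {0, 3}, {0}, {1, 4}, {3, 5}, {0, 4}]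
  | .inr 1 => ![{3, 4}, {2, 4, 5}, {1, 3}, {0, 2}, {0, 1}, {1}]

instance (i : Fin 1) : DecidableRel (T5.arc i) := fun x y =>
  inferInstanceAs (Decidable ((x, y) ∈ ([(0, 1), (0, 2), (1, 2), (1, 3), (1, 4), (2, 3), (3, 0),
    (3, 4), (4, 0)] : List (Fin 5 × Fin 5))))

instance (j : Fin 0) : DecidableRel (T5.edge j) := j.elim0

instance (i : Fin 0) : DecidableRel (T6.arc i) := i.elim0

instance (j : Fin 2) : DecidableRel (T6.edge j) := fun x y =>
  inferInstanceAs (Decidable ((x, y) ∈ ![blueT6, redT6] j ∨ (y, x) ∈ ![blueT6, redT6] j))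

instance : DecidableRel T5.underlying.Adj := fun x y =>
  inferInstanceAs (Decidable ((∃ i, T5.arc i x y ∨ T5.arc i y x) ∨ ∃ j, T5.edge j x y))

instance : DecidableRel T6.underlying.Adj := fun x y =>
  inferInstanceAs (Decidable ((∃ i, T6.arc i x y ∨ T6.arc i y x) ∨ ∃ j, T6.edge j x y))

lemma isPlanar_T5 : IsPlanar T5.underlying :=
  isPlanar_of_straight ![(1, 4), (4, 2), (3, 2), (1, 1), (0, 0)]
    (by decide +kernel) (by decide +kernel) (by decide +kernel)

lemma isPlanar_T6 : IsPlanar T6.underlying :=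
  isPlanar_of_straight ![(4, 3), (0, 6), (4, 2), (5, 0), (7, 2), (5, 3)]
    (by decide +kernel) (by decide +kernel) (by decide +kernel)

lemma intersecting_T5_366 :
    Intersecting (reachSets nbrT5 (2 + 1)) (reachSets nbrT5 (5 + 1)) (reachSets nbrT5 (5 + 1)) := by decide +kernel

lemma intersecting_T5_456 :
    Intersecting (reachSets nbrT5 (3 + 1)) (reachSets nbrT5 (4 + 1)) (reachSets nbrT5 (5 + 1)) := by decide +kernel

lemma intersecting_T5_555 :
    Intersecting (reachSets nbrT5 (4 + 1)) (reachSets nbrT5 (4 + 1)) (reachSets nbrT5 (4 + 1)) := by decide +kernel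

lemma intersecting_T6_255 :
    Intersecting (reachSets nbrT6 (1 + 1)) (reachSets nbrT6 (4 + 1)) (reachSets nbrT6 (4 + 1)) := by decide +kernel

lemma intersecting_T6_345 :
    Intersecting (reachSets nbrT6 (2 + 1)) (reachSets nbrT6 (3 + 1)) (reachSets nbrT6 (4 + 1)) := by decide +kernel

lemma intersecting_T6_444 :
    Intersecting (reachSets nbrT6 (3 + 1)) (reachSets nbrT6 (3 + 1)) (reachSets nbrT6 (3 + 1)) := by decide +kernel

/-- Threads of six vertices of degree two, with seven edges, are reducible, and so are vertices of
degree three that see twelve vertices of degree two; `2 * 12 + 4 = 28`. -/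
theorem isPlanarUniversal_T5 : IsPlanarUniversal.{u} 28 T5 := by
  refine isPlanarUniversal_of_reachSets (N := nbrT5) (b := 5) (s := 12) (by decide +kernel)
    (by decide +kernel) (by decide +kernel) (by norm_num) (by norm_num) (by decide +kernel)
    (by decide +kernel) fun i j k hi hj hk h => ?_
  show Intersecting _ _ _
  obtain rfl | rfl | rfl | rfl : i = 2 ∨ i = 3 ∨ i = 4 ∨ i = 5 := by omega
  · obtain ⟨rfl, rfl⟩ : j = 5 ∧ k = 5 := by omega
    exact intersecting_T5_366
  · obtain ⟨rfl, rfl⟩ | ⟨rfl, rfl⟩ : j = 4 ∧ k = 5 ∨ j = 5 ∧ k = 4 := by omega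
    · exact intersecting_T5_456
    · exact intersecting_T5_456.rotate.rotate.swap
  · obtain ⟨rfl, rfl⟩ | ⟨rfl, rfl⟩ | ⟨rfl, rfl⟩ :
        j = 3 ∧ k = 5 ∨ j = 4 ∧ k = 4 ∨ j = 5 ∧ k = 3 := by omega
    · exact intersecting_T5_456.swap
    · exact intersecting_T5_555
    · exact intersecting_T5_456.rotate
  · obtain ⟨rfl, rfl⟩ | ⟨rfl, rfl⟩ | ⟨rfl, rfl⟩ | ⟨rfl, rfl⟩ :
        j = 2 ∧ k = 5 ∨ j = 3 ∧ k = 4 ∨ j = 4 ∧ k = 3 ∨ j = 5 ∧ k = 2 := by omega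
    · exact intersecting_T5_366.swap
    · exact intersecting_T5_456.rotate.rotate
    · exact intersecting_T5_456.rotate.swap
    · exact intersecting_T5_366.rotate

/-- Threads of five vertices of degree two, with six edges, are reducible, and so are vertices of
degree three that see nine vertices of degree two; `2 * 9 + 4 = 22`. -/
theorem isPlanarUniversal_T6 : IsPlanarUniversal.{u} 22 T6 := by
  refine isPlanarUniversal_of_reachSets (N := nbrT6) (b := 4) (s := 9) (by decide +kernel)
    (by decide +kernel) (by decide +kernel) (by norm_num) (by norm_num) (by decide +kernel)
    (by decide +kernel) fun i j k hi hj hk h => ?_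
  show Intersecting _ _ _
  obtain rfl | rfl | rfl | rfl : i = 1 ∨ i = 2 ∨ i = 3 ∨ i = 4 := by omega
  · obtain ⟨rfl, rfl⟩ : j = 4 ∧ k = 4 := by omega
    exact intersecting_T6_255
  · obtain ⟨rfl, rfl⟩ | ⟨rfl, rfl⟩ : j = 3 ∧ k = 4 ∨ j = 4 ∧ k = 3 := by omega
    · exact intersecting_T6_345
    · exact intersecting_T6_345.rotate.rotate.swap
  · obtain ⟨rfl, rfl⟩ | ⟨rfl, rfl⟩ | ⟨rfl, rfl⟩ :
        j = 2 ∧ k = 4 ∨ j = 3 ∧ k = 3 ∨ j = 4 ∧ k = 2 := by omega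
    · exact intersecting_T6_345.swap
    · exact intersecting_T6_444
    · exact intersecting_T6_345.rotate
  · obtain ⟨rfl, rfl⟩ | ⟨rfl, rfl⟩ | ⟨rfl, rfl⟩ | ⟨rfl, rfl⟩ :
        j = 1 ∧ k = 4 ∨ j = 2 ∧ k = 3 ∨ j = 3 ∧ k = 2 ∨ j = 4 ∧ k = 1 := by omega
    · exact intersecting_T6_255.swap
    · exact intersecting_T6_345.rotate.rotate
    · exact intersecting_T6_345.rotate.swap
    · exact intersecting_T6_255.rotate

end ColoredMixedGraph

theorem theorem3 :
    (IsPlanar ColoredMixedGraph.T5.underlying ∧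
      ColoredMixedGraph.IsPlanarUniversal.{u} 28 ColoredMixedGraph.T5) ∧
    (IsPlanar ColoredMixedGraph.T6.underlying ∧
      ColoredMixedGraph.IsPlanarUniversal.{u} 22 ColoredMixedGraph.T6) :=
  ⟨⟨ColoredMixedGraph.isPlanar_T5, ColoredMixedGraph.isPlanarUniversal_T5⟩,
    ColoredMixedGraph.isPlanar_T6, ColoredMixedGraph.isPlanarUniversal_T6⟩
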